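/- **Conventions.** A *Petri net* $P$ is a pair of functions $s,t\colon T\to\mathbb N[S]$, where $T$ (transitions) and $S$ (places) are sets and $\mathbb N[S]$ is the free commutative monoid on $S$. A morphism $(s,t\colon T\to\mathbb N[S])\to(s',t'\colon T'\to\mathbb N[S'])$ is a pair of functions $f\colon T\to T'$, $g\colon S\to S'$ with $s'f=\mathbb N[g]s$ and $t'f=\mathbb N[g]t$. This gives a category $\mathsf{Petri}$. A *commutative monoidal category* is a strict monoidal category with $a\otimes b=b\otimes a$ and $f\otimes g=g\otimes f$ for all objects $a,b$ and morphisms $f,g$; with strict monoidal functors these form a category $\mathsf{CMC}$. The functor $F\colon\mathsf{Petri}\to\mathsf{CMC}$ sends $P$ to the free commutative monoidal category $FP$ on $P$: its objects are the elements of $\mathbb N[S]$, and its morphisms are generated from the transitions $\tau\colon s(\tau)\to t(\tau)$ and identities under composition and tensor product, modulo the laws of a commutative monoidal category; $F(f,g)$ is $\mathbb N[g]$ on objects and sends the generator $\tau$ to $f(\tau)$. The functor $L\colon\mathsf{Set}\to\mathsf{Petri}$ sends $X$ to the Petri net with set of places $X$ and no transitions, and $L'=F\circ L$. The categories $\mathsf{Petri}$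 and $\mathsf{CMC}$ have finite colimits, and $L$, $F$ and $L'$ are left adjoints. For a left adjoint $K\colon\mathsf{Set}\to\mathsf X$ to a category with finite colimits, let ${}_K\mathbb C\mathbf{sp}(\mathsf X)$ be the symmetric monoidal (pseudo) double category of *structured cospans*: objects are sets; vertical 1-morphisms are functions; horizontal 1-cells $X\nrightarrow Y$ are cospans $KX\xrightarrow{i}C\xleftarrow{o}KY$ in $\mathsf X$; 2-morphisms from this to $KX'\xrightarrow{i'}C'\xleftarrow{o'}KY'$ are triples $(f\colon X\to X',\,g\colon Y\to Y',\,\alpha\colon C\to C')$ with $\alpha i=i'\circ Kf$ and $\alpha o=o'\circ Kg$. Horizontal composition is by (chosen) pushouts, with identities $KX=KX=KX$; the tensor product is by (chosen) coproducts, with legs precomposed with the canonical isomorphisms $K(X+X')\cong KX+KX'$, and with unit the initial object; all coherence isomorphisms are the canonical ones. Put $\mathbb O\mathbf{pen}(\mathsf{Petri})={}_L\mathbb C\mathbf{sp}(\mathsf{Petri})$ and $\mathbb O\mathbf{pen}(\mathsf{CMC})={}_{L'}\mathbb C\mathbf{sp}(\mathsf{CMC})$. A *symmetric monoidal double functor*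 $\Phi\colon\mathbb C\to\mathbb D$ consists of functors $\Phi_0,\Phi_1$ on the categories of objects and of arrows, commuting strictly with source and target, with invertible globular natural comparisons $\Phi_1(M)\odot\Phi_1(N)\cong\Phi_1(M\odot N)$ and $U_{\Phi_0(A)}\cong\Phi_1(U_A)$ compatible with the associator and unitors of $\odot$, such that $\Phi_0$ and $\Phi_1$ are (strong) symmetric monoidal functors, source and target commute with them as monoidal functors, and both comparisons are monoidal natural transformations. **Theorem.** There is a symmetric monoidal double functor $$\mathbb O\mathbf{pen}(F)\colon\mathbb O\mathbf{pen}(\mathsf{Petri})\to\mathbb O\mathbf{pen}(\mathsf{CMC})$$ that is the identity on objects and vertical 1-morphisms, sends a horizontal 1-cell $LX\xrightarrow{i}P\xleftarrow{o}LY$ to $L'X\xrightarrow{Fi}FP\xleftarrow{Fo}L'Y$, and sends a 2-morphism $(f,g,\alpha)$ to $(f,g,F\alpha)$. -/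

import Mathlib

open CategoryTheory CategoryTheory.Limits MonoidalCategory

universe v₀ u₀ v₁ u₁ v₀' u₀' v₁' u₁' u

/-- The total type of a family of horizontal 1-cells: a horizontal 1-cell together with its source
and its target.  These are the objects of the category of arrows of a double category. -/
structure HCell {Obj : Type u₀} (Hor : Obj → Obj → Type u₁) : Type (max u₀ u₁) where
  of ::
  /-- source object -/
  {s : Obj}
  /-- target object -/
  {t : Obj}
  /-- the horizontal 1-cell itself -/
  cell : Hor s t

/-- A (pseudo) double category.  `Obj` is the category of objects; its morphisms are the vertical
1-morphisms.  The category of arrows is `HCell Hor`: its objects are the horizontal 1-cells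
`a ⇸ b`, its morphisms are the 2-morphisms, its composition is vertical composition.  The source
and target functors are `M ↦ M.s`, `M ↦ M.t` on horizontal 1-cells and `S`, `T` on 2-morphisms;
as source and target objects are recorded in the type of a horizontal 1-cell, the required
equations between objects hold by construction.  Horizontal composition is written in
diagrammatic order. -/
structure DoubleCategory where
  /-- objects -/
  Obj : Type u₀
  /-- vertical 1-morphisms -/
  [cat₀ : Category.{v₀} Obj]
  /-- horizontal 1-cells -/
  Hor : Obj → Obj → Type u₁
  /-- 2-morphisms and their vertical composition -/
  [cat₁ : Category.{v₁} (HCell Hor)]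
  /-- the vertical source of a 2-morphism -/
  S : ∀ {M N : HCell Hor}, (M ⟶ N) → (M.s ⟶ N.s)
  /-- the vertical target of a 2-morphism -/
  T : ∀ {M N : HCell Hor}, (M ⟶ N) → (M.t ⟶ N.t)
  S_id : ∀ M : HCell Hor, S (𝟙 M) = 𝟙 M.s
  S_comp : ∀ {M N P : HCell Hor} (f : M ⟶ N) (g : N ⟶ P), S (f ≫ g) = S f ≫ S g
  T_id : ∀ M : HCell Hor, T (𝟙 M) = 𝟙 M.t
  T_comp : ∀ {M N P : HCell Hor} (f : M ⟶ N) (g : N ⟶ P), T (f ≫ g) = T f ≫ T g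
  /-- the identity-assigning functor on objects -/
  U : ∀ a : Obj, Hor a a
  /-- the identity-assigning functor on vertical 1-morphisms -/
  Umap : ∀ {a b : Obj}, (a ⟶ b) → (HCell.of (U a) ⟶ HCell.of (U b))
  S_Umap : ∀ {a b : Obj} (f : a ⟶ b), S (Umap f) = f
  T_Umap : ∀ {a b : Obj} (f : a ⟶ b), T (Umap f) = f
  Umap_id : ∀ a : Obj, Umap (𝟙 a) = 𝟙 (HCell.of (U a))
  Umap_comp : ∀ {a b c : Obj} (f : a ⟶ b) (g : b ⟶ c), Umap (f ≫ g) = Umap f ≫ Umap g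
  /-- composition of horizontal 1-cells -/
  comp : ∀ {a b c : Obj}, Hor a b → Hor b c → Hor a c
  /-- horizontal composition of 2-morphisms with a common vertical boundary -/
  hcomp : ∀ {a b c a' b' c' : Obj} {M : Hor a b} {N : Hor b c} {M' : Hor a' b'} {N' : Hor b' c'}
    (α : HCell.of M ⟶ HCell.of M') (β : HCell.of N ⟶ HCell.of N'), T α = S β →
      (HCell.of (comp M N) ⟶ HCell.of (comp M' N'))
  S_hcomp : ∀ {a b c a' b' c' : Obj} {M : Hor a b} {N : Hor b c} {M' : Hor a' b'} {N' : Hor b' c'}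
    (α : HCell.of M ⟶ HCell.of M') (β : HCell.of N ⟶ HCell.of N') (h : T α = S β),
      S (hcomp α β h) = S α
  T_hcomp : ∀ {a b c a' b' c' : Obj} {M : Hor a b} {N : Hor b c} {M' : Hor a' b'} {N' : Hor b' c'}
    (α : HCell.of M ⟶ HCell.of M') (β : HCell.of N ⟶ HCell.of N') (h : T α = S β),
      T (hcomp α β h) = T β
  hcomp_id : ∀ {a b c : Obj} (M : Hor a b) (N : Hor b c),
    hcomp (𝟙 (HCell.of M)) (𝟙 (HCell.of N)) ((T_id (HCell.of M)).trans (S_id (HCell.of N)).symm) =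
      𝟙 (HCell.of (comp M N))
  /-- the interchange law -/
  hcomp_comp : ∀ {a b c a' b' c' a'' b'' c'' : Obj} {M : Hor a b} {N : Hor b c}
    {M' : Hor a' b'} {N' : Hor b' c'} {M'' : Hor a'' b''} {N'' : Hor b'' c''}
    (α : HCell.of M ⟶ HCell.of M') (β : HCell.of N ⟶ HCell.of N')
    (α' : HCell.of M' ⟶ HCell.of M'') (β' : HCell.of N' ⟶ HCell.of N'')
    (h : T α = S β) (h' : T α' = S β'),
    hcomp (α ≫ α') (β ≫ β') (by rw [T_comp, S_comp, h, h']) = hcomp α β h ≫ hcomp α' β' h'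
  /-- the associator -/
  assoc : ∀ {a b c d : Obj} (M : Hor a b) (N : Hor b c) (P : Hor c d),
    HCell.of (comp (comp M N) P) ≅ HCell.of (comp M (comp N P))
  S_assoc : ∀ {a b c d : Obj} (M : Hor a b) (N : Hor b c) (P : Hor c d),
    S (assoc M N P).hom = 𝟙 a
  T_assoc : ∀ {a b c d : Obj} (M : Hor a b) (N : Hor b c) (P : Hor c d),
    T (assoc M N P).hom = 𝟙 d
  assoc_natural : ∀ {a b c d a' b' c' d' : Obj} {M : Hor a b} {N : Hor b c} {P : Hor c d}
    {M' : Hor a' b'} {N' : Hor b' c'} {P' : Hor c' d'}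
    (α : HCell.of M ⟶ HCell.of M') (β : HCell.of N ⟶ HCell.of N') (γ : HCell.of P ⟶ HCell.of P')
    (h : T α = S β) (h' : T β = S γ),
    hcomp (hcomp α β h) γ ((T_hcomp α β h).trans h') ≫ (assoc M' N' P').hom =
      (assoc M N P).hom ≫ hcomp α (hcomp β γ h') (h.trans (S_hcomp β γ h').symm)
  /-- the left unitor -/
  leftUnitor : ∀ {a b : Obj} (M : Hor a b), HCell.of (comp (U a) M) ≅ HCell.of M
  S_leftUnitor : ∀ {a b : Obj} (M : Hor a b), S (leftUnitor M).hom = 𝟙 a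
  T_leftUnitor : ∀ {a b : Obj} (M : Hor a b), T (leftUnitor M).hom = 𝟙 b
  leftUnitor_natural : ∀ {a b a' b' : Obj} {M : Hor a b} {M' : Hor a' b'}
    (α : HCell.of M ⟶ HCell.of M'),
    hcomp (Umap (a := a) (b := a') (S α)) α (T_Umap _) ≫ (leftUnitor M').hom = (leftUnitor M).hom ≫ α
  /-- the right unitor -/
  rightUnitor : ∀ {a b : Obj} (M : Hor a b), HCell.of (comp M (U b)) ≅ HCell.of M
  S_rightUnitor : ∀ {a b : Obj} (M : Hor a b), S (rightUnitor M).hom = 𝟙 a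
  T_rightUnitor : ∀ {a b : Obj} (M : Hor a b), T (rightUnitor M).hom = 𝟙 b
  rightUnitor_natural : ∀ {a b a' b' : Obj} {M : Hor a b} {M' : Hor a' b'}
    (α : HCell.of M ⟶ HCell.of M'),
    hcomp α (Umap (a := b) (b := b') (T α)) (S_Umap _).symm ≫ (rightUnitor M').hom = (rightUnitor M).hom ≫ α
  pentagon : ∀ {a b c d e : Obj} (M : Hor a b) (N : Hor b c) (P : Hor c d) (Q : Hor d e),
    hcomp (assoc M N P).hom (𝟙 (HCell.of Q)) ((T_assoc M N P).trans (S_id (HCell.of Q)).symm) ≫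
        (assoc M (comp N P) Q).hom ≫
        hcomp (𝟙 (HCell.of M)) (assoc N P Q).hom ((T_id (HCell.of M)).trans (S_assoc N P Q).symm) =
      (assoc (comp M N) P Q).hom ≫ (assoc M N (comp P Q)).hom
  triangle : ∀ {a b c : Obj} (M : Hor a b) (N : Hor b c),
    (assoc M (U b) N).hom ≫
        hcomp (𝟙 (HCell.of M)) (leftUnitor N).hom ((T_id (HCell.of M)).trans (S_leftUnitor N).symm) =
      hcomp (rightUnitor M).hom (𝟙 (HCell.of N)) ((T_rightUnitor M).trans (S_id (HCell.of N)).symm)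

attribute [instance] DoubleCategory.cat₀ DoubleCategory.cat₁

/-- A monoidal double category: a double category with monoidal structures on the category of
objects and on the category of arrows that are strictly preserved by the source and target
functors, the unit of the latter being `U` of the unit of the former, and with globular
comparison isomorphisms `interchange` and `unitComparison` that make `⊗` a double functor and
the associator and the unitors of `⊗` transformations of double functors. -/
structure MonoidalDoubleCategory extends DoubleCategory.{v₀, u₀, v₁, u₁} where
  [mon₀ : MonoidalCategory Obj]
  /-- tensor product of horizontal 1-cells -/
  tensor : ∀ {a b c d : Obj}, Hor a b → Hor c d → Hor (a ⊗ c) (b ⊗ d)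
  /-- tensor product of 2-morphisms -/
  tensorMap : ∀ {a b c d a' b' c' d' : Obj} {M : Hor a b} {N : Hor c d} {M' : Hor a' b'}
    {N' : Hor c' d'}, (HCell.of M ⟶ HCell.of M') → (HCell.of N ⟶ HCell.of N') →
      (HCell.of (tensor M N) ⟶ HCell.of (tensor M' N'))
  S_tensorMap : ∀ {a b c d a' b' c' d' : Obj} {M : Hor a b} {N : Hor c d} {M' : Hor a' b'}
    {N' : Hor c' d'} (α : HCell.of M ⟶ HCell.of M') (β : HCell.of N ⟶ HCell.of N'),
    S (tensorMap α β) = S α ⊗ₘ S β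
  T_tensorMap : ∀ {a b c d a' b' c' d' : Obj} {M : Hor a b} {N : Hor c d} {M' : Hor a' b'}
    {N' : Hor c' d'} (α : HCell.of M ⟶ HCell.of M') (β : HCell.of N ⟶ HCell.of N'),
    T (tensorMap α β) = T α ⊗ₘ T β
  tensorMap_id : ∀ {a b c d : Obj} (M : Hor a b) (N : Hor c d),
    tensorMap (𝟙 (HCell.of M)) (𝟙 (HCell.of N)) = 𝟙 (HCell.of (tensor M N))
  tensorMap_comp : ∀ {a b c d a' b' c' d' a'' b'' c'' d'' : Obj} {M : Hor a b} {N : Hor c d}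
    {M' : Hor a' b'} {N' : Hor c' d'} {M'' : Hor a'' b''} {N'' : Hor c'' d''}
    (α : HCell.of M ⟶ HCell.of M') (β : HCell.of N ⟶ HCell.of N')
    (α' : HCell.of M' ⟶ HCell.of M'') (β' : HCell.of N' ⟶ HCell.of N''),
    tensorMap (α ≫ α') (β ≫ β') = tensorMap α β ≫ tensorMap α' β'
  /-- the associator of the tensor product of horizontal 1-cells -/
  tensorAssoc : ∀ {a b c d e f : Obj} (M : Hor a b) (N : Hor c d) (P : Hor e f),
    HCell.of (tensor (tensor M N) P) ≅ HCell.of (tensor M (tensor N P))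
  S_tensorAssoc : ∀ {a b c d e f : Obj} (M : Hor a b) (N : Hor c d) (P : Hor e f),
    S (tensorAssoc M N P).hom = (α_ a c e).hom
  T_tensorAssoc : ∀ {a b c d e f : Obj} (M : Hor a b) (N : Hor c d) (P : Hor e f),
    T (tensorAssoc M N P).hom = (α_ b d f).hom
  tensorAssoc_natural : ∀ {a b c d e f a' b' c' d' e' f' : Obj}
    {M : Hor a b} {N : Hor c d} {P : Hor e f} {M' : Hor a' b'} {N' : Hor c' d'} {P' : Hor e' f'}
    (α : HCell.of M ⟶ HCell.of M') (β : HCell.of N ⟶ HCell.of N') (γ : HCell.of P ⟶ HCell.of P'),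
    tensorMap (tensorMap α β) γ ≫ (tensorAssoc M' N' P').hom =
      (tensorAssoc M N P).hom ≫ tensorMap α (tensorMap β γ)
  /-- the left unitor of the tensor product of horizontal 1-cells -/
  tensorLeftUnitor : ∀ {a b : Obj} (M : Hor a b),
    HCell.of (tensor (U (𝟙_ Obj)) M) ≅ HCell.of M
  S_tensorLeftUnitor : ∀ {a b : Obj} (M : Hor a b), S (tensorLeftUnitor M).hom = (λ_ a).hom
  T_tensorLeftUnitor : ∀ {a b : Obj} (M : Hor a b), T (tensorLeftUnitor M).hom = (λ_ b).hom
  tensorLeftUnitor_natural : ∀ {a b a' b' : Obj} {M : Hor a b} {M' : Hor a' b'}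
    (α : HCell.of M ⟶ HCell.of M'),
    tensorMap (𝟙 (HCell.of (U (𝟙_ Obj)))) α ≫ (tensorLeftUnitor M').hom =
      (tensorLeftUnitor M).hom ≫ α
  /-- the right unitor of the tensor product of horizontal 1-cells -/
  tensorRightUnitor : ∀ {a b : Obj} (M : Hor a b),
    HCell.of (tensor M (U (𝟙_ Obj))) ≅ HCell.of M
  S_tensorRightUnitor : ∀ {a b : Obj} (M : Hor a b), S (tensorRightUnitor M).hom = (ρ_ a).hom
  T_tensorRightUnitor : ∀ {a b : Obj} (M : Hor a b), T (tensorRightUnitor M).hom = (ρ_ b).hom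
  tensorRightUnitor_natural : ∀ {a b a' b' : Obj} {M : Hor a b} {M' : Hor a' b'}
    (α : HCell.of M ⟶ HCell.of M'),
    tensorMap α (𝟙 (HCell.of (U (𝟙_ Obj)))) ≫ (tensorRightUnitor M').hom =
      (tensorRightUnitor M).hom ≫ α
  tensorPentagon : ∀ {a b c d e f g h : Obj} (M : Hor a b) (N : Hor c d) (P : Hor e f)
    (Q : Hor g h),
    tensorMap (tensorAssoc M N P).hom (𝟙 (HCell.of Q)) ≫ (tensorAssoc M (tensor N P) Q).hom ≫
        tensorMap (𝟙 (HCell.of M)) (tensorAssoc N P Q).hom =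
      (tensorAssoc (tensor M N) P Q).hom ≫ (tensorAssoc M N (tensor P Q)).hom
  tensorTriangle : ∀ {a b c d : Obj} (M : Hor a b) (N : Hor c d),
    (tensorAssoc M (U (𝟙_ Obj)) N).hom ≫
        tensorMap (𝟙 (HCell.of M)) (tensorLeftUnitor N).hom =
      tensorMap (tensorRightUnitor M).hom (𝟙 (HCell.of N))
  /-- the composition comparison of `⊗` -/
  interchange : ∀ {a b c a' b' c' : Obj} (M : Hor a b) (M' : Hor a' b') (N : Hor b c)
    (N' : Hor b' c'),
    HCell.of (comp (tensor M M') (tensor N N')) ≅ HCell.of (tensor (comp M N) (comp M' N'))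
  S_interchange : ∀ {a b c a' b' c' : Obj} (M : Hor a b) (M' : Hor a' b') (N : Hor b c)
    (N' : Hor b' c'), S (interchange M M' N N').hom = 𝟙 (a ⊗ a')
  T_interchange : ∀ {a b c a' b' c' : Obj} (M : Hor a b) (M' : Hor a' b') (N : Hor b c)
    (N' : Hor b' c'), T (interchange M M' N N').hom = 𝟙 (c ⊗ c')
  interchange_natural : ∀ {a b c a' b' c' a₁ b₁ c₁ a₁' b₁' c₁' : Obj}
    {M : Hor a b} {M' : Hor a' b'} {N : Hor b c} {N' : Hor b' c'}
    {M₁ : Hor a₁ b₁} {M₁' : Hor a₁' b₁'} {N₁ : Hor b₁ c₁} {N₁' : Hor b₁' c₁'}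
    (α : HCell.of M ⟶ HCell.of M₁) (α' : HCell.of M' ⟶ HCell.of M₁')
    (β : HCell.of N ⟶ HCell.of N₁) (β' : HCell.of N' ⟶ HCell.of N₁')
    (h : T α = S β) (h' : T α' = S β'),
    hcomp (tensorMap α α') (tensorMap β β') (by rw [T_tensorMap, S_tensorMap, h, h']) ≫
        (interchange M₁ M₁' N₁ N₁').hom =
      (interchange M M' N N').hom ≫ tensorMap (hcomp α β h) (hcomp α' β' h')
  /-- the identity comparison of `⊗` -/
  unitComparison : ∀ a b : Obj, HCell.of (U (a ⊗ b)) ≅ HCell.of (tensor (U a) (U b))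
  S_unitComparison : ∀ a b : Obj, S (unitComparison a b).hom = 𝟙 (a ⊗ b)
  T_unitComparison : ∀ a b : Obj, T (unitComparison a b).hom = 𝟙 (a ⊗ b)
  unitComparison_natural : ∀ {a b a' b' : Obj} (f : a ⟶ a') (g : b ⟶ b'),
    Umap (f ⊗ₘ g) ≫ (unitComparison a' b').hom =
      (unitComparison a b).hom ≫ tensorMap (Umap f) (Umap g)
  /-- `⊗` is compatible with the associator of horizontal composition -/
  interchange_assoc : ∀ {a b c d a' b' c' d' : Obj} (M : Hor a b) (N : Hor b c) (P : Hor c d)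
    (M' : Hor a' b') (N' : Hor b' c') (P' : Hor c' d'),
    hcomp (interchange M M' N N').hom (𝟙 (HCell.of (tensor P P')))
          ((T_interchange M M' N N').trans (S_id (HCell.of (tensor P P'))).symm) ≫
        (interchange (comp M N) (comp M' N') P P').hom ≫
        tensorMap (assoc M N P).hom (assoc M' N' P').hom =
      (assoc (tensor M M') (tensor N N') (tensor P P')).hom ≫
        hcomp (𝟙 (HCell.of (tensor M M'))) (interchange N N' P P').hom
          ((T_id (HCell.of (tensor M M'))).trans (S_interchange N N' P P').symm) ≫
        (interchange M M' (comp N P) (comp N' P')).hom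
  /-- `⊗` is compatible with the left unitor of horizontal composition -/
  interchange_leftUnitor : ∀ {a b a' b' : Obj} (M : Hor a b) (M' : Hor a' b'),
    hcomp (unitComparison a a').hom (𝟙 (HCell.of (tensor M M')))
          ((T_unitComparison a a').trans (S_id (HCell.of (tensor M M'))).symm) ≫
        (interchange (U a) (U a') M M').hom ≫
        tensorMap (leftUnitor M).hom (leftUnitor M').hom =
      (leftUnitor (tensor M M')).hom
  /-- `⊗` is compatible with the right unitor of horizontal composition -/
  interchange_rightUnitor : ∀ {a b a' b' : Obj} (M : Hor a b) (M' : Hor a' b'),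
    hcomp (𝟙 (HCell.of (tensor M M'))) (unitComparison b b').hom
          ((T_id (HCell.of (tensor M M'))).trans (S_unitComparison b b').symm) ≫
        (interchange M M' (U b) (U b')).hom ≫
        tensorMap (rightUnitor M).hom (rightUnitor M').hom =
      (rightUnitor (tensor M M')).hom
  /-- the associator of `⊗` commutes with the composition comparison -/
  tensorAssoc_interchange : ∀ {a b c a' b' c' a'' b'' c'' : Obj}
    (M : Hor a b) (N : Hor b c) (M' : Hor a' b') (N' : Hor b' c')
    (M'' : Hor a'' b'') (N'' : Hor b'' c''),
    (interchange (tensor M M') M'' (tensor N N') N'').hom ≫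
        tensorMap (interchange M M' N N').hom (𝟙 (HCell.of (comp M'' N''))) ≫
        (tensorAssoc (comp M N) (comp M' N') (comp M'' N'')).hom =
      hcomp (tensorAssoc M M' M'').hom (tensorAssoc N N' N'').hom
          ((T_tensorAssoc M M' M'').trans (S_tensorAssoc N N' N'').symm) ≫
        (interchange M (tensor M' M'') N (tensor N' N'')).hom ≫
        tensorMap (𝟙 (HCell.of (comp M N))) (interchange M' M'' N' N'').hom
  /-- the associator of `⊗` commutes with the identity comparison -/
  tensorAssoc_unitComparison : ∀ a b c : Obj,
    (unitComparison (a ⊗ b) c).hom ≫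
        tensorMap (unitComparison a b).hom (𝟙 (HCell.of (U c))) ≫
        (tensorAssoc (U a) (U b) (U c)).hom =
      Umap (α_ a b c).hom ≫ (unitComparison a (b ⊗ c)).hom ≫
        tensorMap (𝟙 (HCell.of (U a))) (unitComparison b c).hom
  /-- the left unitor of `⊗` commutes with the composition comparison -/
  tensorLeftUnitor_interchange : ∀ {a b c : Obj} (M : Hor a b) (N : Hor b c),
    (interchange (U (𝟙_ Obj)) M (U (𝟙_ Obj)) N).hom ≫
        tensorMap (leftUnitor (U (𝟙_ Obj))).hom (𝟙 (HCell.of (comp M N))) ≫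
        (tensorLeftUnitor (comp M N)).hom =
      hcomp (tensorLeftUnitor M).hom (tensorLeftUnitor N).hom
        ((T_tensorLeftUnitor M).trans (S_tensorLeftUnitor N).symm)
  /-- the left unitor of `⊗` commutes with the identity comparison -/
  tensorLeftUnitor_unitComparison : ∀ a : Obj,
    (unitComparison (𝟙_ Obj) a).hom ≫ (tensorLeftUnitor (U a)).hom = Umap (λ_ a).hom
  /-- the right unitor of `⊗` commutes with the composition comparison -/
  tensorRightUnitor_interchange : ∀ {a b c : Obj} (M : Hor a b) (N : Hor b c),
    (interchange M (U (𝟙_ Obj)) N (U (𝟙_ Obj))).hom ≫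
        tensorMap (𝟙 (HCell.of (comp M N))) (leftUnitor (U (𝟙_ Obj))).hom ≫
        (tensorRightUnitor (comp M N)).hom =
      hcomp (tensorRightUnitor M).hom (tensorRightUnitor N).hom
        ((T_tensorRightUnitor M).trans (S_tensorRightUnitor N).symm)
  /-- the right unitor of `⊗` commutes with the identity comparison -/
  tensorRightUnitor_unitComparison : ∀ a : Obj,
    (unitComparison a (𝟙_ Obj)).hom ≫ (tensorRightUnitor (U a)).hom = Umap (ρ_ a).hom

attribute [instance] MonoidalDoubleCategory.mon₀

/-- A symmetric monoidal double category: a monoidal double category with a symmetry on the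
category of objects and on the category of arrows, strictly preserved by the source and target
functors, which is a transformation of double functors. -/
structure SymmetricMonoidalDoubleCategory extends MonoidalDoubleCategory.{v₀, u₀, v₁, u₁} where
  [sym₀ : SymmetricCategory Obj]
  /-- the braiding of the tensor product of horizontal 1-cells -/
  braiding : ∀ {a b c d : Obj} (M : Hor a b) (N : Hor c d),
    HCell.of (tensor M N) ≅ HCell.of (tensor N M)
  S_braiding : ∀ {a b c d : Obj} (M : Hor a b) (N : Hor c d), S (braiding M N).hom = (β_ a c).hom
  T_braiding : ∀ {a b c d : Obj} (M : Hor a b) (N : Hor c d), T (braiding M N).hom = (β_ b d).hom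
  braiding_natural : ∀ {a b c d a' b' c' d' : Obj} {M : Hor a b} {N : Hor c d} {M' : Hor a' b'}
    {N' : Hor c' d'} (α : HCell.of M ⟶ HCell.of M') (β : HCell.of N ⟶ HCell.of N'),
    tensorMap α β ≫ (braiding M' N').hom = (braiding M N).hom ≫ tensorMap β α
  hexagon_forward : ∀ {a b c d e f : Obj} (M : Hor a b) (N : Hor c d) (P : Hor e f),
    (tensorAssoc M N P).hom ≫ (braiding M (tensor N P)).hom ≫ (tensorAssoc N P M).hom =
      tensorMap (braiding M N).hom (𝟙 (HCell.of P)) ≫ (tensorAssoc N M P).hom ≫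
        tensorMap (𝟙 (HCell.of N)) (braiding M P).hom
  hexagon_reverse : ∀ {a b c d e f : Obj} (M : Hor a b) (N : Hor c d) (P : Hor e f),
    (tensorAssoc M N P).inv ≫ (braiding (tensor M N) P).hom ≫ (tensorAssoc P M N).inv =
      tensorMap (𝟙 (HCell.of M)) (braiding N P).hom ≫ (tensorAssoc M P N).inv ≫
        tensorMap (braiding M P).hom (𝟙 (HCell.of N))
  symmetry : ∀ {a b c d : Obj} (M : Hor a b) (N : Hor c d),
    (braiding M N).hom ≫ (braiding N M).hom = 𝟙 (HCell.of (tensor M N))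
  /-- the braiding commutes with the composition comparison -/
  braiding_interchange : ∀ {a b c a' b' c' : Obj} (M : Hor a b) (M' : Hor a' b') (N : Hor b c)
    (N' : Hor b' c'),
    (interchange M M' N N').hom ≫ (braiding (comp M N) (comp M' N')).hom =
      hcomp (braiding M M').hom (braiding N N').hom
          ((T_braiding M M').trans (S_braiding N N').symm) ≫
        (interchange M' M N' N).hom
  /-- the braiding commutes with the identity comparison -/
  braiding_unitComparison : ∀ a b : Obj,
    (unitComparison a b).hom ≫ (braiding (U a) (U b)).hom =
      Umap (β_ a b).hom ≫ (unitComparison b a).hom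

attribute [instance] SymmetricMonoidalDoubleCategory.sym₀

/-! ### Structured cospans -/

section StructuredCospans

universe vA uA vX uX

variable {A : Type uA} [Category.{vA} A] {X : Type uX} [Category.{vX} X]

/-- A horizontal 1-cell `a ⇸ b`: a cospan `L a ⟶ x ⟵ L b`. -/
structure StructuredCospan (L : A ⥤ X) (a b : A) : Type (max uX vX) where
  /-- the object `x` -/
  apex : X
  /-- the input leg -/
  left : L.obj a ⟶ apex
  /-- the output leg -/
  right : L.obj b ⟶ apex

namespace StructuredCospan

variable {L : A ⥤ X}

/-- A 2-morphism of structured cospans: a commutative diagram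
from `L a ⟶ x ⟵ L b` to `L a' ⟶ x' ⟵ L b'` whose outer vertical maps are `L f` and `L g`. -/
@[ext]
structure Hom (M N : HCell (StructuredCospan L)) : Type (max vA vX) where
  /-- the vertical source `f` -/
  src : M.s ⟶ N.s
  /-- the vertical target `g` -/
  tgt : M.t ⟶ N.t
  /-- the map of apices -/
  mid : M.cell.apex ⟶ N.cell.apex
  left_comm : M.cell.left ≫ mid = L.map src ≫ N.cell.left
  right_comm : M.cell.right ≫ mid = L.map tgt ≫ N.cell.right

instance : Category.{max vA vX} (HCell (StructuredCospan L)) where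
  Hom := Hom
  id M := ⟨𝟙 _, 𝟙 _, 𝟙 _, by simp, by simp⟩
  comp f g := ⟨f.src ≫ g.src, f.tgt ≫ g.tgt, f.mid ≫ g.mid,
    by rw [← Category.assoc, f.left_comm, Category.assoc, g.left_comm]; simp,
    by rw [← Category.assoc, f.right_comm, Category.assoc, g.right_comm]; simp⟩
  id_comp f := by apply Hom.ext <;> simp
  comp_id f := by apply Hom.ext <;> simp
  assoc f g h := by apply Hom.ext <;> simp

section lemmas

theorem hom_ext {M N : HCell (StructuredCospan L)} {f g : M ⟶ N} (h₁ : f.src = g.src)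
    (h₂ : f.tgt = g.tgt) (h₃ : f.mid = g.mid) : f = g := Hom.ext h₁ h₂ h₃

variable {a b a' b' a'' b'' : A} {M : StructuredCospan L a b} {N : StructuredCospan L a' b'}
  {P : StructuredCospan L a'' b''} (f : HCell.of M ⟶ HCell.of N) (g : HCell.of N ⟶ HCell.of P)

@[simp] theorem id_src : Hom.src (𝟙 (HCell.of M)) = 𝟙 a := rfl
@[simp] theorem id_tgt : Hom.tgt (𝟙 (HCell.of M)) = 𝟙 b := rfl
@[simp] theorem id_mid : Hom.mid (𝟙 (HCell.of M)) = 𝟙 M.apex := rfl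
@[simp] theorem comp_src : (f ≫ g).src = f.src ≫ g.src := rfl
@[simp] theorem comp_tgt : (f ≫ g).tgt = f.tgt ≫ g.tgt := rfl
@[simp] theorem comp_mid : (f ≫ g).mid = f.mid ≫ g.mid := rfl

@[simp] theorem left_mid : M.left ≫ f.mid = L.map f.src ≫ N.left := f.left_comm
@[simp] theorem right_mid : M.right ≫ f.mid = L.map f.tgt ≫ N.right := f.right_comm
@[simp] theorem left_mid_assoc {Z : X} (k : N.apex ⟶ Z) :
    M.left ≫ f.mid ≫ k = L.map f.src ≫ N.left ≫ k := by
  rw [← Category.assoc, left_mid, Category.assoc]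
@[simp] theorem right_mid_assoc {Z : X} (k : N.apex ⟶ Z) :
    M.right ≫ f.mid ≫ k = L.map f.tgt ≫ N.right ≫ k := by
  rw [← Category.assoc, right_mid, Category.assoc]

end lemmas

/-- An isomorphism of structured cospans from isomorphisms of the sources, targets and apices. -/
@[simps]
def isoMk {a b a' b' : A} {M : StructuredCospan L a b} {N : StructuredCospan L a' b'}
    (f : a ≅ a') (g : b ≅ b') (e : M.apex ≅ N.apex)
    (hl : M.left ≫ e.hom = L.map f.hom ≫ N.left)
    (hr : M.right ≫ e.hom = L.map g.hom ≫ N.right) : HCell.of M ≅ HCell.of N where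
  hom := ⟨f.hom, g.hom, e.hom, hl, hr⟩
  inv := ⟨f.inv, g.inv, e.inv,
    by simp only [← cancel_mono e.hom, Category.assoc, hl]; simp [← Functor.map_comp_assoc],
    by simp only [← cancel_mono e.hom, Category.assoc, hr]; simp [← Functor.map_comp_assoc]⟩
  hom_inv_id := by apply hom_ext <;> simp
  inv_hom_id := by apply hom_ext <;> simp

/-- The identity cospan `L a ⟶ L a ⟵ L a`. -/
def unit (L : A ⥤ X) (a : A) : StructuredCospan L a a := ⟨L.obj a, 𝟙 _, 𝟙 _⟩

/-- Maps out of the apex of `unit L a`. -/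
def unitDesc {a : A} {Z : X} (k : L.obj a ⟶ Z) : (unit L a).apex ⟶ Z := k

section

variable {a b : A} {Z W : X}

theorem unit_right : (unit L a).right = (unit L a).left := rfl
@[simp] theorem unit_left_desc (k : L.obj a ⟶ Z) : (unit L a).left ≫ unitDesc k = k :=
  Category.id_comp k
@[simp] theorem unit_left_desc_assoc (k : L.obj a ⟶ Z) (l : Z ⟶ W) :
    (unit L a).left ≫ unitDesc k ≫ l = k ≫ l := by rw [← Category.assoc, unit_left_desc]
@[simp] theorem unit_right_desc (k : L.obj a ⟶ Z) : (unit L a).right ≫ unitDesc k = k :=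
  Category.id_comp k
@[simp] theorem unit_right_desc_assoc (k : L.obj a ⟶ Z) (l : Z ⟶ W) :
    (unit L a).right ≫ unitDesc k ≫ l = k ≫ l := by rw [← Category.assoc, unit_right_desc]
theorem unit_hom_ext {k l : (unit L a).apex ⟶ Z} (h : (unit L a).left ≫ k = (unit L a).left ≫ l) :
    k = l :=
  ((Category.id_comp k).symm.trans h).trans (Category.id_comp l)

end

/-- The identity 2-morphism of a vertical 1-morphism. -/
@[simps]
def unitMap {a b : A} (f : a ⟶ b) : HCell.of (unit L a) ⟶ HCell.of (unit L b) :=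
  ⟨f, f, unitDesc (L.map f ≫ (unit L b).left), by simp, by simp [unit_right]⟩

section comp

variable [HasPushouts X]

/-- Composition of cospans by pushout. -/
noncomputable def comp {a b c : A} (M : StructuredCospan L a b) (N : StructuredCospan L b c) :
    StructuredCospan L a c :=
  ⟨pushout M.right N.left, M.left ≫ pushout.inl _ _, N.right ≫ pushout.inr _ _⟩

variable {a b c d a' b' c' : A}

section

variable (M : StructuredCospan L a b) (N : StructuredCospan L b c) {Z W : X}

/-- The first inclusion into the pushout. -/
noncomputable def compInl : M.apex ⟶ (comp M N).apex := pushout.inl _ _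
/-- The second inclusion into the pushout. -/
noncomputable def compInr : N.apex ⟶ (comp M N).apex := pushout.inr _ _

@[simp] theorem comp_left : (comp M N).left = M.left ≫ compInl M N := rfl
@[simp] theorem comp_right : (comp M N).right = N.right ≫ compInr M N := rfl

theorem comp_condition : M.right ≫ compInl M N = N.left ≫ compInr M N := pushout.condition
theorem comp_condition_assoc (k : (comp M N).apex ⟶ Z) :
    M.right ≫ compInl M N ≫ k = N.left ≫ compInr M N ≫ k := by
  rw [← Category.assoc, comp_condition, Category.assoc]

variable {M N}

/-- Maps out of the pushout. -/
noncomputable def compDesc (k : M.apex ⟶ Z) (l : N.apex ⟶ Z) (h : M.right ≫ k = N.left ≫ l) :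
    (comp M N).apex ⟶ Z := pushout.desc k l h

section
variable (k : M.apex ⟶ Z) (l : N.apex ⟶ Z) (h : M.right ≫ k = N.left ≫ l) (m : Z ⟶ W)
@[simp] theorem compInl_desc : compInl M N ≫ compDesc k l h = k := pushout.inl_desc _ _ _
@[simp] theorem compInr_desc : compInr M N ≫ compDesc k l h = l := pushout.inr_desc _ _ _
@[simp] theorem compInl_desc_assoc : compInl M N ≫ compDesc k l h ≫ m = k ≫ m := by
  rw [← Category.assoc, compInl_desc]
@[simp] theorem compInr_desc_assoc : compInr M N ≫ compDesc k l h ≫ m = l ≫ m := by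
  rw [← Category.assoc, compInr_desc]
end

theorem comp_hom_ext {k l : (comp M N).apex ⟶ Z} (h₁ : compInl M N ≫ k = compInl M N ≫ l)
    (h₂ : compInr M N ≫ k = compInr M N ≫ l) : k = l := pushout.hom_ext h₁ h₂

end

/-- The horizontal composite of 2-morphisms, induced by the universal property of the pushout. -/
@[simps]
noncomputable def hcomp {M : StructuredCospan L a b} {N : StructuredCospan L b c}
    {M' : StructuredCospan L a' b'} {N' : StructuredCospan L b' c'}
    (α : HCell.of M ⟶ HCell.of M') (β : HCell.of N ⟶ HCell.of N') (h : α.tgt = β.src) :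
    HCell.of (comp M N) ⟶ HCell.of (comp M' N') :=
  ⟨α.src, β.tgt,
    compDesc (α.mid ≫ compInl M' N') (β.mid ≫ compInr M' N') (by simp [h, comp_condition]),
    by simp, by simp⟩

/-- The associator of horizontal composition. -/
noncomputable def assoc (M : StructuredCospan L a b) (N : StructuredCospan L b c)
    (P : StructuredCospan L c d) :
    HCell.of (comp (comp M N) P) ≅ HCell.of (comp M (comp N P)) :=
  isoMk (Iso.refl _) (Iso.refl _)
    { hom := compDesc
        (compDesc (compInl M (comp N P)) (compInl N P ≫ compInr M (comp N P))
          (by simp [comp_condition M (comp N P)]))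
        (compInr N P ≫ compInr M (comp N P))
        (by simp [comp_condition_assoc N P])
      inv := compDesc (compInl M N ≫ compInl (comp M N) P)
        (compDesc (compInr M N ≫ compInl (comp M N) P) (compInr (comp M N) P)
          (by simp [← comp_condition (comp M N) P]))
        (by simp [comp_condition_assoc M N])
      hom_inv_id := by
        apply comp_hom_ext
        · apply comp_hom_ext <;> simp
        · simp
      inv_hom_id := by
        apply comp_hom_ext
        · simp
        · apply comp_hom_ext <;> simp }
    (by simp) (by simp)

/-- The left unitor of horizontal composition. -/
noncomputable def leftUnitor (M : StructuredCospan L a b) :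
    HCell.of (comp (unit L a) M) ≅ HCell.of M :=
  isoMk (Iso.refl _) (Iso.refl _)
    { hom := compDesc (unitDesc M.left) (𝟙 _) (by simp)
      inv := compInr _ _
      hom_inv_id := by
        apply comp_hom_ext
        · apply unit_hom_ext
          simp [← comp_condition, unit_right]
        · simp
      inv_hom_id := by simp }
    (by simp) (by simp)

/-- The right unitor of horizontal composition. -/
noncomputable def rightUnitor (M : StructuredCospan L a b) :
    HCell.of (comp M (unit L b)) ≅ HCell.of M :=
  isoMk (Iso.refl _) (Iso.refl _)
    { hom := compDesc (𝟙 _) (unitDesc M.right) (by simp)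
      inv := compInl _ _
      hom_inv_id := by
        apply comp_hom_ext
        · simp
        · apply unit_hom_ext
          simp [comp_condition]
      inv_hom_id := by simp }
    (by simp) (by simp)

/-- The double category of structured cospans. -/
noncomputable abbrev doubleCategory (L : A ⥤ X) : DoubleCategory where
  Obj := A
  Hor := StructuredCospan L
  S := Hom.src
  T := Hom.tgt
  S_id _ := rfl
  S_comp _ _ := rfl
  T_id _ := rfl
  T_comp _ _ := rfl
  U := unit L
  Umap := unitMap
  S_Umap f := unitMap_src f
  T_Umap f := unitMap_tgt f
  Umap_id a := by
    apply hom_ext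
    · rfl
    · rfl
    · apply unit_hom_ext; simp
  Umap_comp f g := by
    apply hom_ext
    · rfl
    · rfl
    · apply unit_hom_ext; simp
  comp := comp
  hcomp := hcomp
  S_hcomp _ _ _ := rfl
  T_hcomp _ _ _ := rfl
  hcomp_id M N := by
    apply hom_ext
    · rfl
    · rfl
    · apply comp_hom_ext <;> simp
  hcomp_comp α β α' β' h h' := by
    apply hom_ext
    · rfl
    · rfl
    · apply comp_hom_ext <;> simp
  assoc := assoc
  S_assoc _ _ _ := rfl
  T_assoc _ _ _ := rfl
  assoc_natural α β γ h h' := by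
    apply hom_ext
    · simp [assoc]
    · simp [assoc]
    · apply comp_hom_ext
      · apply comp_hom_ext <;> simp [assoc]
      · simp [assoc]
  leftUnitor := leftUnitor
  S_leftUnitor _ := rfl
  T_leftUnitor _ := rfl
  leftUnitor_natural α := by
    apply hom_ext
    · simp [leftUnitor]
    · simp [leftUnitor]
    · apply comp_hom_ext
      · apply unit_hom_ext
        simp [leftUnitor]
      · simp [leftUnitor]
  rightUnitor := rightUnitor
  S_rightUnitor _ := rfl
  T_rightUnitor _ := rfl
  rightUnitor_natural α := by
    apply hom_ext
    · simp [rightUnitor]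
    · simp [rightUnitor]
    · apply comp_hom_ext
      · simp [rightUnitor]
      · apply unit_hom_ext
        simp [rightUnitor]
  pentagon M N P Q := by
    apply hom_ext
    · simp [assoc]
    · simp [assoc]
    · apply comp_hom_ext
      · apply comp_hom_ext
        · apply comp_hom_ext <;> simp [assoc]
        · simp [assoc]
      · simp [assoc]
  triangle M N := by
    apply hom_ext
    · simp [assoc, rightUnitor]
    · simp [assoc, leftUnitor]
    · apply comp_hom_ext
      · apply comp_hom_ext
        · simp [assoc, rightUnitor]
        · apply unit_hom_ext
          simp [assoc, rightUnitor, leftUnitor, comp_condition]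
      · simp [assoc, leftUnitor]

end comp

section tensor

variable [HasFiniteCoproducts A]

variable (A) in
/-- The monoidal structure on `A` given by (chosen) binary coproducts and initial object. -/
noncomputable def coprodMonoidal : MonoidalCategory A := monoidalOfHasFiniteCoproducts A

attribute [local instance] coprodMonoidal

variable (A) in
/-- The symmetry `a ⨿ b ≅ b ⨿ a`. -/
noncomputable def coprodSymmetric : SymmetricCategory A := symmetricOfHasFiniteCoproducts A

attribute [local instance] coprodSymmetric

theorem comp_eq_assoc {C : Type*} [Category C] {w x y z : C} {f : w ⟶ x} {g : x ⟶ y} {k : w ⟶ y}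
    (h : f ≫ g = k) (l : y ⟶ z) : f ≫ g ≫ l = k ≫ l := by rw [← h, Category.assoc]

/-- The first coproduct inclusion. -/
noncomputable def aInl (a b : A) : a ⟶ a ⊗ b := (coprod.inl : a ⟶ a ⨿ b)

/-- The second coproduct inclusion. -/
noncomputable def aInr (a b : A) : b ⟶ a ⊗ b := (coprod.inr : b ⟶ a ⨿ b)

variable (L) in
/-- The image under `L` of the first coproduct inclusion. -/
noncomputable def lInl (a b : A) : L.obj a ⟶ L.obj (a ⊗ b) := L.map (aInl a b)

variable (L) in
/-- The image under `L` of the second coproduct inclusion. -/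
noncomputable def lInr (a b : A) : L.obj b ⟶ L.obj (a ⊗ b) := L.map (aInr a b)

section

variable {a b c a' b' : A}

@[simp] theorem lInl_map (f : a ⟶ a') (g : b ⟶ b') :
    lInl L a b ≫ L.map (f ⊗ₘ g) = L.map f ≫ lInl L a' b' := by
  unfold lInl
  rw [← L.map_comp, ← L.map_comp]
  exact congrArg L.map (coprod.inl_map f g)
@[simp] theorem lInr_map (f : a ⟶ a') (g : b ⟶ b') :
    lInr L a b ≫ L.map (f ⊗ₘ g) = L.map g ≫ lInr L a' b' := by
  unfold lInr
  rw [← L.map_comp, ← L.map_comp]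
  exact congrArg L.map (coprod.inr_map f g)

theorem aInl_assoc : aInl (a ⊗ b) c ≫ (α_ a b c).hom =
    coprod.desc (aInl a (b ⊗ c)) (aInl b c ≫ aInr a (b ⊗ c)) :=
  coprod.inl_desc (X := a ⨿ b) (Y := c) _ _

@[simp] theorem lInl_lInl_assoc :
    lInl L a b ≫ lInl L (a ⊗ b) c ≫ L.map (α_ a b c).hom = lInl L a (b ⊗ c) := by
  unfold lInl
  rw [← L.map_comp, ← L.map_comp, aInl_assoc]
  exact congrArg L.map (coprod.inl_desc _ _)
@[simp] theorem lInr_lInl_assoc :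
    lInr L a b ≫ lInl L (a ⊗ b) c ≫ L.map (α_ a b c).hom = lInl L b c ≫ lInr L a (b ⊗ c) := by
  unfold lInl lInr
  rw [← L.map_comp, ← L.map_comp, ← L.map_comp, aInl_assoc]
  exact congrArg L.map (coprod.inr_desc _ _)
@[simp] theorem lInr_assoc :
    lInr L (a ⊗ b) c ≫ L.map (α_ a b c).hom = lInr L b c ≫ lInr L a (b ⊗ c) := by
  unfold lInr
  rw [← L.map_comp, ← L.map_comp]
  exact congrArg L.map (coprod.inr_desc (X := a ⨿ b) (Y := c) _ _)
@[simp] theorem lInr_leftUnitor : lInr L (𝟙_ A) a ≫ L.map (λ_ a).hom = 𝟙 _ := by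
  unfold lInr
  rw [← L.map_comp, ← L.map_id]
  exact congrArg L.map (coprod.inr_desc (X := 𝟙_ A) (Y := a) _ _)
@[simp] theorem lInl_rightUnitor : lInl L a (𝟙_ A) ≫ L.map (ρ_ a).hom = 𝟙 _ := by
  unfold lInl
  rw [← L.map_comp, ← L.map_id]
  exact congrArg L.map (coprod.inl_desc (X := a) (Y := 𝟙_ A) _ _)
@[simp] theorem lInl_braiding : lInl L a b ≫ L.map (β_ a b).hom = lInr L b a := by
  unfold lInl lInr
  rw [← L.map_comp]
  exact congrArg L.map (coprod.inl_desc (X := a) (Y := b) _ _)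
@[simp] theorem lInr_braiding : lInr L a b ≫ L.map (β_ a b).hom = lInl L b a := by
  unfold lInl lInr
  rw [← L.map_comp]
  exact congrArg L.map (coprod.inr_desc (X := a) (Y := b) _ _)

variable {Z : X}

@[simp] theorem lInl_map' (f : a ⟶ a') (g : b ⟶ b') (k : L.obj (a' ⊗ b') ⟶ Z) :
    lInl L a b ≫ L.map (f ⊗ₘ g) ≫ k = L.map f ≫ lInl L a' b' ≫ k := by
  rw [comp_eq_assoc (lInl_map f g), Category.assoc]
@[simp] theorem lInr_map' (f : a ⟶ a') (g : b ⟶ b') (k : L.obj (a' ⊗ b') ⟶ Z) :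
    lInr L a b ≫ L.map (f ⊗ₘ g) ≫ k = L.map g ≫ lInr L a' b' ≫ k := by
  rw [comp_eq_assoc (lInr_map f g), Category.assoc]
@[simp] theorem lInl_lInl_assoc' (k : L.obj (a ⊗ b ⊗ c) ⟶ Z) :
    lInl L a b ≫ lInl L (a ⊗ b) c ≫ L.map (α_ a b c).hom ≫ k = lInl L a (b ⊗ c) ≫ k := by
  rw [← lInl_lInl_assoc]; simp only [Category.assoc]
@[simp] theorem lInr_lInl_assoc' (k : L.obj (a ⊗ b ⊗ c) ⟶ Z) :
    lInr L a b ≫ lInl L (a ⊗ b) c ≫ L.map (α_ a b c).hom ≫ k =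
      lInl L b c ≫ lInr L a (b ⊗ c) ≫ k := by
  rw [← Category.assoc (lInl L b c), ← lInr_lInl_assoc]; simp only [Category.assoc]
@[simp] theorem lInr_assoc' (k : L.obj (a ⊗ b ⊗ c) ⟶ Z) :
    lInr L (a ⊗ b) c ≫ L.map (α_ a b c).hom ≫ k = lInr L b c ≫ lInr L a (b ⊗ c) ≫ k := by
  rw [comp_eq_assoc lInr_assoc, Category.assoc]
@[simp] theorem lInr_leftUnitor' (k : L.obj a ⟶ Z) :
    lInr L (𝟙_ A) a ≫ L.map (λ_ a).hom ≫ k = k := by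
  rw [comp_eq_assoc lInr_leftUnitor, Category.id_comp]
@[simp] theorem lInl_rightUnitor' (k : L.obj a ⟶ Z) :
    lInl L a (𝟙_ A) ≫ L.map (ρ_ a).hom ≫ k = k := by
  rw [comp_eq_assoc lInl_rightUnitor, Category.id_comp]
@[simp] theorem lInl_braiding' (k : L.obj (b ⊗ a) ⟶ Z) :
    lInl L a b ≫ L.map (β_ a b).hom ≫ k = lInr L b a ≫ k := comp_eq_assoc lInl_braiding k
@[simp] theorem lInr_braiding' (k : L.obj (b ⊗ a) ⟶ Z) :
    lInr L a b ≫ L.map (β_ a b).hom ≫ k = lInl L b a ≫ k := comp_eq_assoc lInr_braiding k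

end

variable [HasFiniteColimits X] [L.IsLeftAdjoint]

variable (L) in
/-- The canonical map `L (a ⊗ b) ⟶ L a ⨿ L b`, inverse to the comparison map. -/
noncomputable def lSplit (a b : A) : L.obj (a ⊗ b) ⟶ L.obj a ⨿ L.obj b :=
  (PreservesColimitPair.iso L a b).inv

theorem lInl_split (a b : A) : lInl L a b ≫ lSplit L a b = coprod.inl :=
  (Iso.comp_inv_eq _).2 (coprodComparison_inl L (A := a) (B := b)).symm

theorem lInr_split (a b : A) : lInr L a b ≫ lSplit L a b = coprod.inr :=
  (Iso.comp_inv_eq _).2 (coprodComparison_inr L (A := a) (B := b)).symm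

theorem l_hom_ext {a b : A} {Z : X} {k l : L.obj (a ⊗ b) ⟶ Z} (h₁ : lInl L a b ≫ k = lInl L a b ≫ l)
    (h₂ : lInr L a b ≫ k = lInr L a b ≫ l) : k = l := by
  have key : ∀ m : L.obj (a ⊗ b) ⟶ Z,
      m = lSplit L a b ≫ coprod.desc (lInl L a b ≫ m) (lInr L a b ≫ m) := fun m => by
    refine (Iso.eq_inv_comp _).2 ?_
    apply coprod.hom_ext
    · exact (comp_eq_assoc (coprodComparison_inl L (A := a) (B := b)) m).trans
        (coprod.inl_desc _ _).symm
    · exact (comp_eq_assoc (coprodComparison_inr L (A := a) (B := b)) m).trans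
        (coprod.inr_desc _ _).symm
  rw [key k, key l, h₁, h₂]

variable (L) in
/-- `L` of the chosen initial object is initial. -/
noncomputable def lInitial : IsInitial (L.obj (𝟙_ A)) :=
  IsInitial.isInitialObj L _ (initialIsInitial (C := A))

/-- The tensor product of structured cospans: the coproduct of the cospans, whose legs are
precomposed with the canonical isomorphisms `L (a ⊗ c) ≅ L a ⨿ L c`. -/
noncomputable def tensor {a b c d : A} (M : StructuredCospan L a b) (N : StructuredCospan L c d) :
    StructuredCospan L (a ⊗ c) (b ⊗ d) :=
  ⟨M.apex ⨿ N.apex, lSplit L a c ≫ coprod.map M.left N.left,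
    lSplit L b d ≫ coprod.map M.right N.right⟩

variable {a b c d e f g h a' b' c' d' e' f' : A}

section

variable (M : StructuredCospan L a b) (N : StructuredCospan L c d) {Z W : X}

/-- The first coproduct inclusion of apices. -/
noncomputable def tInl : M.apex ⟶ (tensor M N).apex := (coprod.inl : _ ⟶ M.apex ⨿ N.apex)
/-- The second coproduct inclusion of apices. -/
noncomputable def tInr : N.apex ⟶ (tensor M N).apex := (coprod.inr : _ ⟶ M.apex ⨿ N.apex)

@[simp] theorem lInl_left : lInl L a c ≫ (tensor M N).left = M.left ≫ tInl M N := by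
  refine (comp_eq_assoc (lInl_split a c) _).trans ?_
  exact coprod.inl_map _ _
@[simp] theorem lInr_left : lInr L a c ≫ (tensor M N).left = N.left ≫ tInr M N := by
  refine (comp_eq_assoc (lInr_split a c) _).trans ?_
  exact coprod.inr_map _ _
@[simp] theorem lInl_right : lInl L b d ≫ (tensor M N).right = M.right ≫ tInl M N := by
  refine (comp_eq_assoc (lInl_split b d) _).trans ?_
  exact coprod.inl_map _ _
@[simp] theorem lInr_right : lInr L b d ≫ (tensor M N).right = N.right ≫ tInr M N := by
  refine (comp_eq_assoc (lInr_split b d) _).trans ?_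
  exact coprod.inr_map _ _
@[simp] theorem lInl_left' (k : (tensor M N).apex ⟶ Z) :
    lInl L a c ≫ (tensor M N).left ≫ k = M.left ≫ tInl M N ≫ k := by
  rw [comp_eq_assoc (lInl_left M N), Category.assoc]
@[simp] theorem lInr_left' (k : (tensor M N).apex ⟶ Z) :
    lInr L a c ≫ (tensor M N).left ≫ k = N.left ≫ tInr M N ≫ k := by
  rw [comp_eq_assoc (lInr_left M N), Category.assoc]
@[simp] theorem lInl_right' (k : (tensor M N).apex ⟶ Z) :
    lInl L b d ≫ (tensor M N).right ≫ k = M.right ≫ tInl M N ≫ k := by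
  rw [comp_eq_assoc (lInl_right M N), Category.assoc]
@[simp] theorem lInr_right' (k : (tensor M N).apex ⟶ Z) :
    lInr L b d ≫ (tensor M N).right ≫ k = N.right ≫ tInr M N ≫ k := by
  rw [comp_eq_assoc (lInr_right M N), Category.assoc]

variable {M N}

/-- Maps out of the coproduct of apices. -/
noncomputable def tDesc (k : M.apex ⟶ Z) (l : N.apex ⟶ Z) : (tensor M N).apex ⟶ Z :=
  coprod.desc k l

variable (k : M.apex ⟶ Z) (l : N.apex ⟶ Z) (m : Z ⟶ W)
@[simp] theorem tInl_desc : tInl M N ≫ tDesc k l = k := coprod.inl_desc _ _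
@[simp] theorem tInr_desc : tInr M N ≫ tDesc k l = l := coprod.inr_desc _ _
@[simp] theorem tInl_desc' : tInl M N ≫ tDesc k l ≫ m = k ≫ m := comp_eq_assoc (tInl_desc k l) m
@[simp] theorem tInr_desc' : tInr M N ≫ tDesc k l ≫ m = l ≫ m := comp_eq_assoc (tInr_desc k l) m

theorem t_hom_ext {k l : (tensor M N).apex ⟶ Z} (h₁ : tInl M N ≫ k = tInl M N ≫ l)
    (h₂ : tInr M N ≫ k = tInr M N ≫ l) : k = l := coprod.hom_ext h₁ h₂

end

/-- The tensor product of 2-morphisms. -/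
@[simps]
noncomputable def tensorMap {M : StructuredCospan L a b} {N : StructuredCospan L c d}
    {M' : StructuredCospan L a' b'} {N' : StructuredCospan L c' d'}
    (α : HCell.of M ⟶ HCell.of M') (β : HCell.of N ⟶ HCell.of N') :
    HCell.of (tensor M N) ⟶ HCell.of (tensor M' N') :=
  ⟨α.src ⊗ₘ β.src, α.tgt ⊗ₘ β.tgt, tDesc (α.mid ≫ tInl M' N') (β.mid ≫ tInr M' N'),
    by apply l_hom_ext <;> simp, by apply l_hom_ext <;> simp⟩

/-- The associator of the tensor product. -/
noncomputable def tensorAssoc (M : StructuredCospan L a b) (N : StructuredCospan L c d)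
    (P : StructuredCospan L e f) :
    HCell.of (tensor (tensor M N) P) ≅ HCell.of (tensor M (tensor N P)) :=
  isoMk (α_ a c e) (α_ b d f)
    { hom := tDesc (tDesc (tInl M (tensor N P)) (tInl N P ≫ tInr M (tensor N P)))
        (tInr N P ≫ tInr M (tensor N P))
      inv := tDesc (tInl M N ≫ tInl (tensor M N) P)
        (tDesc (tInr M N ≫ tInl (tensor M N) P) (tInr (tensor M N) P))
      hom_inv_id := by
        apply t_hom_ext
        · apply t_hom_ext <;> simp
        · simp
      inv_hom_id := by
        apply t_hom_ext
        · simp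
        · apply t_hom_ext <;> simp }
    (by
      apply l_hom_ext
      · apply l_hom_ext <;> simp
      · simp)
    (by
      apply l_hom_ext
      · apply l_hom_ext <;> simp
      · simp)

/-- The left unitor of the tensor product. -/
noncomputable def tensorLeftUnitor (M : StructuredCospan L a b) :
    HCell.of (tensor (unit L (𝟙_ A)) M) ≅ HCell.of M :=
  isoMk (λ_ a) (λ_ b)
    { hom := tDesc (unitDesc ((lInitial L).to _)) (𝟙 _)
      inv := tInr _ _
      hom_inv_id := by
        apply t_hom_ext
        · apply unit_hom_ext
          exact (lInitial L).hom_ext _ _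
        · simp
      inv_hom_id := by simp }
    (by
      apply l_hom_ext
      · exact (lInitial L).hom_ext _ _
      · simp)
    (by
      apply l_hom_ext
      · exact (lInitial L).hom_ext _ _
      · simp)

/-- The right unitor of the tensor product. -/
noncomputable def tensorRightUnitor (M : StructuredCospan L a b) :
    HCell.of (tensor M (unit L (𝟙_ A))) ≅ HCell.of M :=
  isoMk (ρ_ a) (ρ_ b)
    { hom := tDesc (𝟙 _) (unitDesc ((lInitial L).to _))
      inv := tInl _ _
      hom_inv_id := by
        apply t_hom_ext
        · simp
        · apply unit_hom_ext
          exact (lInitial L).hom_ext _ _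
      inv_hom_id := by simp }
    (by
      apply l_hom_ext
      · simp
      · exact (lInitial L).hom_ext _ _)
    (by
      apply l_hom_ext
      · simp
      · exact (lInitial L).hom_ext _ _)

/-- The braiding of the tensor product. -/
noncomputable def braiding (M : StructuredCospan L a b) (N : StructuredCospan L c d) :
    HCell.of (tensor M N) ≅ HCell.of (tensor N M) :=
  isoMk (β_ a c) (β_ b d)
    { hom := tDesc (tInr N M) (tInl N M)
      inv := tDesc (tInr M N) (tInl M N)
      hom_inv_id := by apply t_hom_ext <;> simp
      inv_hom_id := by apply t_hom_ext <;> simp }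
    (by apply l_hom_ext <;> simp) (by apply l_hom_ext <;> simp)

theorem tInl_condition (M : StructuredCospan L a b) (M' : StructuredCospan L a' b')
    (N : StructuredCospan L b c) (N' : StructuredCospan L b' c') :
    M.right ≫ tInl M M' ≫ compInl (tensor M M') (tensor N N') =
      N.left ≫ tInl N N' ≫ compInr (tensor M M') (tensor N N') := by
  have := congrArg (lInl L b b' ≫ ·) (comp_condition (tensor M M') (tensor N N'))
  simpa using this

theorem tInr_condition (M : StructuredCospan L a b) (M' : StructuredCospan L a' b')
    (N : StructuredCospan L b c) (N' : StructuredCospan L b' c') :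
    M'.right ≫ tInr M M' ≫ compInl (tensor M M') (tensor N N') =
      N'.left ≫ tInr N N' ≫ compInr (tensor M M') (tensor N N') := by
  have := congrArg (lInr L b b' ≫ ·) (comp_condition (tensor M M') (tensor N N'))
  simpa using this

/-- The comparison between the composite of tensor products and the tensor product of
composites. -/
noncomputable def interchange (M : StructuredCospan L a b) (M' : StructuredCospan L a' b')
    (N : StructuredCospan L b c) (N' : StructuredCospan L b' c') :
    HCell.of (comp (tensor M M') (tensor N N')) ≅ HCell.of (tensor (comp M N) (comp M' N')) :=
  isoMk (Iso.refl _) (Iso.refl _)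
    { hom := compDesc
        (tDesc (compInl M N ≫ tInl (comp M N) (comp M' N'))
          (compInl M' N' ≫ tInr (comp M N) (comp M' N')))
        (tDesc (compInr M N ≫ tInl (comp M N) (comp M' N'))
          (compInr M' N' ≫ tInr (comp M N) (comp M' N')))
        (by apply l_hom_ext <;> simp [comp_condition_assoc])
      inv := tDesc
        (compDesc (tInl M M' ≫ compInl _ _) (tInl N N' ≫ compInr _ _) (tInl_condition _ _ _ _))
        (compDesc (tInr M M' ≫ compInl _ _) (tInr N N' ≫ compInr _ _) (tInr_condition _ _ _ _))
      hom_inv_id := by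
        apply comp_hom_ext <;> apply t_hom_ext <;> simp
      inv_hom_id := by
        apply t_hom_ext <;> apply comp_hom_ext <;> simp }
    (by apply l_hom_ext <;> simp) (by apply l_hom_ext <;> simp)

/-- The comparison between the identity cospan of a tensor product and the tensor product of the
identity cospans. -/
noncomputable def unitComparison (L : A ⥤ X) [L.IsLeftAdjoint] (a b : A) :
    HCell.of (unit L (a ⊗ b)) ≅ HCell.of (tensor (unit L a) (unit L b)) :=
  isoMk (Iso.refl _) (Iso.refl _)
    { hom := unitDesc (tensor (unit L a) (unit L b)).left
      inv := tDesc (unitDesc (lInl L a b ≫ (unit L (a ⊗ b)).left))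
        (unitDesc (lInr L a b ≫ (unit L (a ⊗ b)).left))
      hom_inv_id := by
        apply unit_hom_ext
        apply l_hom_ext <;> simp
      inv_hom_id := by
        apply t_hom_ext <;> apply unit_hom_ext <;> simp }
    (by simp) (by apply l_hom_ext <;> simp [unit_right])

end tensor

section symmetricMonoidal

attribute [local instance] coprodMonoidal coprodSymmetric

variable [HasFiniteCoproducts A] [HasFiniteColimits X]

/-- The monoidal double category of structured cospans. -/
noncomputable abbrev monoidalDoubleCategory (L : A ⥤ X) [L.IsLeftAdjoint] :
    MonoidalDoubleCategory where
  toDoubleCategory := doubleCategory L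
  mon₀ := coprodMonoidal A
  tensor := tensor
  tensorMap := tensorMap
  S_tensorMap _ _ := rfl
  T_tensorMap _ _ := rfl
  tensorMap_id M N := by
    apply hom_ext
    · simp
    · simp
    · apply t_hom_ext <;> simp
  tensorMap_comp α β α' β' := by
    apply hom_ext
    · simp
    · simp
    · apply t_hom_ext <;> simp
  tensorAssoc := tensorAssoc
  S_tensorAssoc _ _ _ := rfl
  T_tensorAssoc _ _ _ := rfl
  tensorAssoc_natural α β γ := by
    apply hom_ext
    · simp [tensorAssoc]
    · simp [tensorAssoc]
    · apply t_hom_ext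
      · apply t_hom_ext <;> simp [tensorAssoc]
      · simp [tensorAssoc]
  tensorLeftUnitor := tensorLeftUnitor
  S_tensorLeftUnitor _ := rfl
  T_tensorLeftUnitor _ := rfl
  tensorLeftUnitor_natural α := by
    apply hom_ext
    · simp [tensorLeftUnitor]
    · simp [tensorLeftUnitor]
    · apply t_hom_ext
      · apply unit_hom_ext
        exact (lInitial L).hom_ext _ _
      · simp [tensorLeftUnitor]
  tensorRightUnitor := tensorRightUnitor
  S_tensorRightUnitor _ := rfl
  T_tensorRightUnitor _ := rfl
  tensorRightUnitor_natural α := by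
    apply hom_ext
    · simp [tensorRightUnitor]
    · simp [tensorRightUnitor]
    · apply t_hom_ext
      · simp [tensorRightUnitor]
      · apply unit_hom_ext
        exact (lInitial L).hom_ext _ _
  tensorPentagon M N P Q := by
    apply hom_ext
    · simp [tensorAssoc]
    · simp [tensorAssoc]
    · apply t_hom_ext
      · apply t_hom_ext
        · apply t_hom_ext <;> simp [tensorAssoc]
        · simp [tensorAssoc]
      · simp [tensorAssoc]
  tensorTriangle M N := by
    apply hom_ext
    · simp [tensorAssoc, tensorLeftUnitor, tensorRightUnitor]
    · simp [tensorAssoc, tensorLeftUnitor, tensorRightUnitor]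
    · apply t_hom_ext
      · apply t_hom_ext
        · simp [tensorAssoc, tensorLeftUnitor, tensorRightUnitor]
        · apply unit_hom_ext
          exact (lInitial L).hom_ext _ _
      · simp [tensorAssoc, tensorLeftUnitor]
  interchange := interchange
  S_interchange _ _ _ _ := rfl
  T_interchange _ _ _ _ := rfl
  interchange_natural α α' β β' h h' := by
    apply hom_ext
    · simp [interchange]
    · simp [interchange]
    · apply comp_hom_ext <;> apply t_hom_ext <;> simp [interchange]
  unitComparison := unitComparison L
  S_unitComparison _ _ := rfl
  T_unitComparison _ _ := rfl
  unitComparison_natural f g := by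
    apply hom_ext
    · simp [unitComparison]
    · simp [unitComparison]
    · apply unit_hom_ext
      apply l_hom_ext <;> simp [unitComparison]
  interchange_assoc M N P M' N' P' := by
    apply hom_ext
    · simp [interchange, assoc]
    · simp [interchange, assoc]
    · apply comp_hom_ext
      · apply comp_hom_ext <;> apply t_hom_ext <;> simp [interchange, assoc]
      · apply t_hom_ext <;> simp [interchange, assoc]
  interchange_leftUnitor M M' := by
    apply hom_ext
    · simp [interchange, unitComparison, leftUnitor]
    · simp [interchange, unitComparison, leftUnitor]
    · apply comp_hom_ext
      · apply unit_hom_ext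
        apply l_hom_ext <;> simp [interchange, unitComparison, leftUnitor]
      · apply t_hom_ext <;> simp [interchange, leftUnitor]
  interchange_rightUnitor M M' := by
    apply hom_ext
    · simp [interchange, unitComparison, rightUnitor]
    · simp [interchange, unitComparison, rightUnitor]
    · apply comp_hom_ext
      · apply t_hom_ext <;> simp [interchange, rightUnitor]
      · apply unit_hom_ext
        apply l_hom_ext <;> simp [interchange, unitComparison, rightUnitor, ← unit_right]
  tensorAssoc_interchange M N M' N' M'' N'' := by
    apply hom_ext
    · simp [interchange, tensorAssoc]
    · simp [interchange, tensorAssoc]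
    · apply comp_hom_ext <;> apply t_hom_ext
      · apply t_hom_ext <;> simp [interchange, tensorAssoc]
      · simp [interchange, tensorAssoc]
      · apply t_hom_ext <;> simp [interchange, tensorAssoc]
      · simp [interchange, tensorAssoc]
  tensorAssoc_unitComparison a b c := by
    apply hom_ext
    · simp [unitComparison, tensorAssoc]
    · simp [unitComparison, tensorAssoc]
    · apply unit_hom_ext
      apply l_hom_ext
      · apply l_hom_ext <;> simp [unitComparison, tensorAssoc]
      · simp [unitComparison, tensorAssoc]
  tensorLeftUnitor_interchange M N := by
    apply hom_ext
    · simp [interchange, tensorLeftUnitor, leftUnitor]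
    · simp [interchange, tensorLeftUnitor, leftUnitor]
    · apply comp_hom_ext
      · apply t_hom_ext
        · apply unit_hom_ext
          exact (lInitial L).hom_ext _ _
        · simp [interchange, tensorLeftUnitor]
      · apply t_hom_ext
        · apply unit_hom_ext
          exact (lInitial L).hom_ext _ _
        · simp [interchange, tensorLeftUnitor]
  tensorLeftUnitor_unitComparison a := by
    apply hom_ext
    · simp [unitComparison, tensorLeftUnitor]
    · simp [unitComparison, tensorLeftUnitor]
    · apply unit_hom_ext
      apply l_hom_ext
      · exact (lInitial L).hom_ext _ _
      · simp [unitComparison, tensorLeftUnitor]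
  tensorRightUnitor_interchange M N := by
    apply hom_ext
    · simp [interchange, tensorRightUnitor, leftUnitor]
    · simp [interchange, tensorRightUnitor, leftUnitor]
    · apply comp_hom_ext
      · apply t_hom_ext
        · simp [interchange, tensorRightUnitor]
        · apply unit_hom_ext
          exact (lInitial L).hom_ext _ _
      · apply t_hom_ext
        · simp [interchange, tensorRightUnitor]
        · apply unit_hom_ext
          exact (lInitial L).hom_ext _ _
  tensorRightUnitor_unitComparison a := by
    apply hom_ext
    · simp [unitComparison, tensorRightUnitor]
    · simp [unitComparison, tensorRightUnitor]
    · apply unit_hom_ext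
      apply l_hom_ext
      · simp [unitComparison, tensorRightUnitor]
      · exact (lInitial L).hom_ext _ _

/-- The symmetric monoidal double category of structured cospans. -/
noncomputable abbrev symmetricMonoidalDoubleCategory (L : A ⥤ X) [L.IsLeftAdjoint] :
    SymmetricMonoidalDoubleCategory where
  toMonoidalDoubleCategory := monoidalDoubleCategory L
  sym₀ := coprodSymmetric A
  braiding := braiding
  S_braiding _ _ := rfl
  T_braiding _ _ := rfl
  braiding_natural α β := by
    apply hom_ext
    · simp [braiding]
    · simp [braiding]
    · apply t_hom_ext <;> simp [braiding]
  hexagon_forward M N P := by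
    apply hom_ext
    · simp [braiding, tensorAssoc]
    · simp [braiding, tensorAssoc]
    · apply t_hom_ext
      · apply t_hom_ext <;> simp [braiding, tensorAssoc]
      · simp [braiding, tensorAssoc]
  hexagon_reverse M N P := by
    apply hom_ext
    · simp [braiding, tensorAssoc]
    · simp [braiding, tensorAssoc]
    · apply t_hom_ext
      · simp [braiding, tensorAssoc]
      · apply t_hom_ext <;> simp [braiding, tensorAssoc]
  symmetry M N := by
    apply hom_ext
    · simp [braiding]
    · simp [braiding]
    · apply t_hom_ext <;> simp [braiding]
  braiding_interchange M M' N N' := by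
    apply hom_ext
    · simp [interchange, braiding]
    · simp [interchange, braiding]
    · apply comp_hom_ext <;> apply t_hom_ext <;> simp [interchange, braiding]
  braiding_unitComparison a b := by
    apply hom_ext
    · simp [unitComparison, braiding]
    · simp [unitComparison, braiding]
    · apply unit_hom_ext
      apply l_hom_ext <;> simp [unitComparison, braiding]

end symmetricMonoidal

end StructuredCospan

end StructuredCospans

/-! ### Petri nets -/

/-- A Petri net: a set `S` of places, a set `T` of transitions, and source and target functions
from `T` to the free commutative monoid on `S`, i.e. the finite multisets of elements of `S`. -/
structure PetriNet : Type (u + 1) where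
  /-- places -/
  S : Type u
  /-- transitions -/
  T : Type u
  /-- source -/
  src : T → Multiset S
  /-- target -/
  tgt : T → Multiset S

namespace PetriNet

/-- A morphism of Petri nets: functions on transitions and on places compatible with source and
target. -/
@[ext]
structure Hom (P Q : PetriNet.{u}) : Type u where
  /-- the function on transitions -/
  onT : P.T → Q.T
  /-- the function on places -/
  onS : P.S → Q.S
  src_comm : ∀ τ, (P.src τ).map onS = Q.src (onT τ)
  tgt_comm : ∀ τ, (P.tgt τ).map onS = Q.tgt (onT τ)

/-- The category of Petri nets. -/
instance : Category.{u} PetriNet.{u} where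
  Hom := Hom
  id P := ⟨id, id, by simp, by simp⟩
  comp f g := ⟨g.onT ∘ f.onT, g.onS ∘ f.onS,
    fun τ => by rw [← Multiset.map_map, f.src_comm, g.src_comm]; rfl,
    fun τ => by rw [← Multiset.map_map, f.tgt_comm, g.tgt_comm]; rfl⟩

theorem hom_ext {P Q : PetriNet.{u}} {f g : P ⟶ Q} (h₁ : ∀ τ, f.onT τ = g.onT τ)
    (h₂ : ∀ x, f.onS x = g.onS x) : f = g :=
  Hom.ext (funext h₁) (funext h₂)

@[simp] theorem id_onT (P : PetriNet.{u}) (τ : P.T) : Hom.onT (𝟙 P) τ = τ := rfl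
@[simp] theorem id_onS (P : PetriNet.{u}) (x : P.S) : Hom.onS (𝟙 P) x = x := rfl
@[simp] theorem comp_onT {P Q R : PetriNet.{u}} (f : P ⟶ Q) (g : Q ⟶ R) (τ : P.T) :
    (f ≫ g).onT τ = g.onT (f.onT τ) := rfl
@[simp] theorem comp_onS {P Q R : PetriNet.{u}} (f : P ⟶ Q) (g : Q ⟶ R) (x : P.S) :
    (f ≫ g).onS x = g.onS (f.onS x) := rfl

/-- The set of places, as a functor. -/
def places : PetriNet.{u} ⥤ Type u where
  obj P := P.S
  map f := TypeCat.ofHom f.onS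

/-- The set of transitions, as a functor. -/
def transitions : PetriNet.{u} ⥤ Type u where
  obj P := P.T
  map f := TypeCat.ofHom f.onT

/-- The functor `L` from sets to Petri nets: `L X` has `X` as set of places and no transitions. -/
def L : Type u ⥤ PetriNet.{u} where
  obj X := ⟨X, PEmpty, PEmpty.elim, PEmpty.elim⟩
  map f := ⟨id, f, fun τ => τ.elim, fun τ => τ.elim⟩
  map_id _ := hom_ext (fun τ => τ.elim) (fun _ => rfl)
  map_comp _ _ := hom_ext (fun τ => τ.elim) (fun _ => rfl)

/-- `L` is left adjoint to the functor of places. -/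
def adjunction : L.{u} ⊣ places.{u} :=
  Adjunction.mkOfHomEquiv
    { homEquiv := fun _ _ =>
        { toFun := fun f => TypeCat.ofHom f.onS
          invFun := fun f => ⟨PEmpty.elim, f, fun τ => τ.elim, fun τ => τ.elim⟩
          left_inv := fun _ => hom_ext (fun τ => τ.elim) (fun _ => rfl)
          right_inv := fun _ => rfl }
      homEquiv_naturality_left_symm := fun _ _ => hom_ext (fun τ => τ.elim) (fun _ => rfl)
      homEquiv_naturality_right := fun _ _ => rfl }

instance : L.{u}.IsLeftAdjoint := adjunction.isLeftAdjoint

section colimits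

variable {J : Type u} [Category.{u} J] (D : J ⥤ PetriNet.{u})

/-- Assignments of multisets of places to transitions, as a cocone. -/
noncomputable def boundaryCocone (σ : ∀ P : PetriNet.{u}, P.T → Multiset P.S)
    (hσ : ∀ {P Q : PetriNet.{u}} (f : P ⟶ Q) (τ : P.T), (σ P τ).map f.onS = σ Q (f.onT τ)) :
    Cocone (D ⋙ transitions) where
  pt := Multiset (colimit (D ⋙ places))
  ι :=
    { app := fun j => TypeCat.ofHom fun τ => (σ (D.obj j) τ).map (colimit.ι (D ⋙ places) j)
      naturality := fun j j' f => by
        ext τ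
        change (σ (D.obj j') ((D.map f).onT τ)).map (colimit.ι (D ⋙ places) j') =
          (σ (D.obj j) τ).map (colimit.ι (D ⋙ places) j)
        refine (congrArg _ (hσ (D.map f) τ).symm).trans ?_
        refine (Multiset.map_map _ _ _).trans (Multiset.map_congr rfl fun x _ => ?_)
        exact ConcreteCategory.congr_hom (colimit.w (D ⋙ places) f) x }

/-- The colimit of a diagram of Petri nets, computed on places and on transitions. -/
noncomputable def colimitNet : PetriNet.{u} where
  S := colimit (D ⋙ places)
  T := colimit (D ⋙ transitions)
  src := colimit.desc _ (boundaryCocone D PetriNet.src fun f => f.src_comm)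
  tgt := colimit.desc _ (boundaryCocone D PetriNet.tgt fun f => f.tgt_comm)

/-- The colimit cocone of a diagram of Petri nets. -/
noncomputable def colimitCocone : Cocone D where
  pt := colimitNet D
  ι :=
    { app := fun j =>
        ⟨colimit.ι (D ⋙ transitions) j, colimit.ι (D ⋙ places) j,
          fun τ => (ConcreteCategory.congr_hom (colimit.ι_desc
            (boundaryCocone D PetriNet.src fun f => f.src_comm) j) τ).symm,
          fun τ => (ConcreteCategory.congr_hom (colimit.ι_desc
            (boundaryCocone D PetriNet.tgt fun f => f.tgt_comm) j) τ).symm⟩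
      naturality := fun _ _ f => hom_ext
        (fun τ => ConcreteCategory.congr_hom (colimit.w (D ⋙ transitions) f) τ)
        (fun x => ConcreteCategory.congr_hom (colimit.w (D ⋙ places) f) x) }

theorem ι_desc_onS (s : Cocone D) (j : J) (x : (D.obj j).S) :
    colimit.desc (D ⋙ places) (places.mapCocone s) (colimit.ι (D ⋙ places) j x) =
      (s.ι.app j).onS x :=
  ConcreteCategory.congr_hom (colimit.ι_desc (places.mapCocone s) j) x

theorem ι_desc_onT (s : Cocone D) (j : J) (x : (D.obj j).T) :
    colimit.desc (D ⋙ transitions) (transitions.mapCocone s)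
      (colimit.ι (D ⋙ transitions) j x) = (s.ι.app j).onT x :=
  ConcreteCategory.congr_hom (colimit.ι_desc (transitions.mapCocone s) j) x

/-- The universal property of the colimit. -/
noncomputable def isColimitColimitCocone : IsColimit (colimitCocone D) where
  desc s :=
    ⟨colimit.desc (D ⋙ transitions) (transitions.mapCocone s),
      colimit.desc (D ⋙ places) (places.mapCocone s),
      fun τ => by
        obtain ⟨j, τ, rfl⟩ := Types.jointly_surjective' τ
        refine Eq.trans ?_ (congrArg _ (ι_desc_onT D s j τ).symm)
        refine Eq.trans ?_ ((s.ι.app j).src_comm τ)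
        refine (congrArg _ (((colimitCocone D).ι.app j).src_comm τ).symm).trans ?_
        refine (Multiset.map_map _ _ _).trans (Multiset.map_congr rfl fun x _ => ?_)
        exact ι_desc_onS D s j x,
      fun τ => by
        obtain ⟨j, τ, rfl⟩ := Types.jointly_surjective' τ
        refine Eq.trans ?_ (congrArg _ (ι_desc_onT D s j τ).symm)
        refine Eq.trans ?_ ((s.ι.app j).tgt_comm τ)
        refine (congrArg _ (((colimitCocone D).ι.app j).tgt_comm τ).symm).trans ?_
        refine (Multiset.map_map _ _ _).trans (Multiset.map_congr rfl fun x _ => ?_)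
        exact ι_desc_onS D s j x⟩
  fac s j := hom_ext (fun τ => ι_desc_onT D s j τ) (fun x => ι_desc_onS D s j x)
  uniq s m h := hom_ext
    (fun τ => by
      obtain ⟨j, τ, rfl⟩ := Types.jointly_surjective' τ
      refine Eq.trans ?_ (ι_desc_onT D s j τ).symm
      rw [← h j]
      rfl)
    (fun x => by
      obtain ⟨j, x, rfl⟩ := Types.jointly_surjective' x
      refine Eq.trans ?_ (ι_desc_onS D s j x).symm
      rw [← h j]
      rfl)

end colimits

instance : HasColimits PetriNet.{u} where
  has_colimits_of_shape _ _ :=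
    { has_colimit := fun D => ⟨⟨⟨colimitCocone D, isColimitColimitCocone D⟩⟩⟩ }

end PetriNet

/-! ### Commutative monoidal categories -/

/-- A commutative monoidal category: a category whose objects form a commutative monoid, with a
tensor product of morphisms that is functorial and strictly associative, unital and commutative.
The tensor product of objects is written `+` and the unit object `0`. -/
structure CMC : Type (u + 1) where
  /-- objects -/
  Ob : Type u
  [monoid : AddCommMonoid Ob]
  [cat : Category.{u} Ob]
  /-- the tensor product of morphisms -/
  tensor : ∀ {a b a' b' : Ob}, (a ⟶ b) → (a' ⟶ b') → (a + a' ⟶ b + b')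
  tensor_id : ∀ a a' : Ob, tensor (𝟙 a) (𝟙 a') = 𝟙 (a + a')
  tensor_comp : ∀ {a b c a' b' c' : Ob} (f : a ⟶ b) (g : b ⟶ c) (f' : a' ⟶ b') (g' : b' ⟶ c'),
    tensor (f ≫ g) (f' ≫ g') = tensor f f' ≫ tensor g g'
  tensor_assoc : ∀ {a b a' b' a'' b'' : Ob} (f : a ⟶ b) (g : a' ⟶ b') (h : a'' ⟶ b''),
    HEq (tensor (tensor f g) h) (tensor f (tensor g h))
  zero_tensor : ∀ {a b : Ob} (f : a ⟶ b), HEq (tensor (𝟙 0) f) f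
  tensor_comm : ∀ {a b a' b' : Ob} (f : a ⟶ b) (g : a' ⟶ b'), HEq (tensor f g) (tensor g f)

namespace CMC

attribute [instance] CMC.monoid CMC.cat

/-- A strict monoidal functor between commutative monoidal categories. -/
structure Hom (C D : CMC.{u}) : Type u where
  /-- the action on objects -/
  obj : C.Ob →+ D.Ob
  /-- the action on morphisms -/
  map : ∀ {a b : C.Ob}, (a ⟶ b) → (obj a ⟶ obj b)
  map_id : ∀ a : C.Ob, map (𝟙 a) = 𝟙 (obj a)
  map_comp : ∀ {a b c : C.Ob} (f : a ⟶ b) (g : b ⟶ c), map (f ≫ g) = map f ≫ map g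
  map_tensor : ∀ {a b a' b' : C.Ob} (f : a ⟶ b) (g : a' ⟶ b'),
    HEq (map (C.tensor f g)) (D.tensor (map f) (map g))

theorem Hom.map_heq {C D : CMC.{u}} (F : Hom C D) {a b a' b' : C.Ob} {f : a ⟶ b} {g : a' ⟶ b'}
    (h₁ : a = a') (h₂ : b = b') (h : HEq f g) : HEq (F.map f) (F.map g) := by
  subst h₁ h₂
  rw [eq_of_heq h]

/-- The category of commutative monoidal categories and strict monoidal functors. -/
instance : Category.{u} CMC.{u} where
  Hom := Hom
  id C := ⟨AddMonoidHom.id _, fun f => f, fun _ => rfl, fun _ _ => rfl, fun _ _ => HEq.rfl⟩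
  comp F G := ⟨G.obj.comp F.obj, fun f => G.map (F.map f),
    fun a => by rw [F.map_id, G.map_id]; rfl,
    fun f g => by rw [F.map_comp, G.map_comp],
    fun f g => (G.map_heq (map_add _ _ _) (map_add _ _ _) (F.map_tensor f g)).trans
      (G.map_tensor (F.map f) (F.map g))⟩

/-- Equality of morphisms that may have different sources and targets. -/
inductive Same {C : CMC.{u}} : ∀ {a b a' b' : C.Ob}, (a ⟶ b) → (a' ⟶ b') → Prop
  | refl {a b : C.Ob} (f : a ⟶ b) : Same f f

section Same

variable {C D : CMC.{u}} {a b c a' b' c' a'' b'' d e d' e' : C.Ob}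

theorem Same.symm {f : a ⟶ b} {g : a' ⟶ b'} (h : Same f g) : Same g f := by
  cases h; exact .refl _

theorem Same.trans {f : a ⟶ b} {g : a' ⟶ b'} {k : a'' ⟶ b''} (h : Same f g) (h' : Same g k) :
    Same f k := by
  cases h; exact h'

theorem Same.heq {f : a ⟶ b} {g : a' ⟶ b'} (h : Same f g) : HEq f g := by
  cases h; rfl

theorem Same.eq {f g : a ⟶ b} (h : Same f g) : f = g := eq_of_heq h.heq

theorem Same.of_eq {f g : a ⟶ b} (h : f = g) : Same f g := h ▸ .refl f

theorem Same.of_heq {f : a ⟶ b} {g : a' ⟶ b'} (h₁ : a = a') (h₂ : b = b') (h : HEq f g) :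
    Same f g := by
  subst h₁ h₂
  exact .of_eq (eq_of_heq h)

theorem Same.left {f : a ⟶ b} {g : a' ⟶ b'} (h : Same f g) : a = a' := by cases h; rfl

theorem Same.right {f : a ⟶ b} {g : a' ⟶ b'} (h : Same f g) : b = b' := by cases h; rfl

theorem Same.comp {f : a ⟶ b} {g : b ⟶ c} {f' : a' ⟶ b'} {g' : b' ⟶ c'} (h : Same f f')
    (h' : Same g g') : Same (f ≫ g) (f' ≫ g') := by
  cases h; cases h'; exact .refl _

theorem Same.tensor {f : a ⟶ b} {g : d ⟶ e} {f' : a' ⟶ b'} {g' : d' ⟶ e'} (h : Same f f')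
    (h' : Same g g') : Same (C.tensor f g) (C.tensor f' g') := by
  cases h; cases h'; exact .refl _

theorem Same.map (F : C ⟶ D) {f : a ⟶ b} {g : a' ⟶ b'} (h : Same f g) :
    Same (Hom.map F f) (Hom.map F g) := by
  cases h; exact .refl _

theorem same_id {a a' : C.Ob} (h : a = a') : Same (𝟙 a) (𝟙 a') := by
  subst h; exact .refl _

theorem same_cast {x y : C.Ob} (h₁ : a = x) (h₂ : b = y) (f : a ⟶ b) :
    Same (cast (by rw [h₁, h₂]) f : x ⟶ y) f := by
  subst h₁ h₂; exact .refl _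

theorem same_map_tensor (F : C ⟶ D) (f : a ⟶ b) (g : a' ⟶ b') :
    Same (F.map (C.tensor f g)) (D.tensor (F.map f) (F.map g)) :=
  .of_heq (map_add _ _ _) (map_add _ _ _) (F.map_tensor f g)

theorem same_assoc (f : a ⟶ b) (g : a' ⟶ b') (h : d ⟶ e) :
    Same (C.tensor (C.tensor f g) h) (C.tensor f (C.tensor g h)) :=
  .of_heq (add_assoc _ _ _) (add_assoc _ _ _) (C.tensor_assoc f g h)

theorem same_zero (f : a ⟶ b) : Same (C.tensor (𝟙 0) f) f :=
  .of_heq (zero_add _) (zero_add _) (C.zero_tensor f)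

theorem same_comm (f : a ⟶ b) (g : a' ⟶ b') : Same (C.tensor f g) (C.tensor g f) :=
  .of_heq (add_comm _ _) (add_comm _ _) (C.tensor_comm f g)

@[simp] theorem id_obj (x : C.Ob) : Hom.obj (𝟙 C) x = x := rfl

@[simp] theorem comp_obj {E : CMC.{u}} (F : C ⟶ D) (G : D ⟶ E) (x : C.Ob) :
    (F ≫ G).obj x = G.obj (F.obj x) := rfl

theorem hom_ext {F G : C ⟶ D} (h₁ : ∀ x, F.obj x = G.obj x)
    (h₂ : ∀ {a b : C.Ob} (f : a ⟶ b), Same (F.map f) (G.map f)) : F = G := by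
  obtain ⟨o, m, _, _, _⟩ := F
  obtain ⟨o', m', _, _, _⟩ := G
  obtain rfl : o = o' := AddMonoidHom.ext h₁
  obtain rfl : @m = @m' := by
    funext a b f
    exact (h₂ f).eq
  rfl

end Same

/-! #### Presentations of commutative monoidal categories -/

section presentation

variable {M G : Type u} [AddCommMonoid M] (s t : G → M)

/-- The morphisms generated recursively by generators `g : s g ⟶ t g`, identities, composition and
tensor product. -/
inductive Term : M → M → Type u
  | gen (g : G) : Term (s g) (t g)
  | id (a : M) : Term a a
  | comp {a b c : M} (f : Term a b) (g : Term b c) : Term a c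
  | add {a b a' b' : M} (f : Term a b) (f' : Term a' b') : Term (a + a') (b + b')

/-- The equivalence relation on generated morphisms imposing the laws of a commutative monoidal
category and a family `R` of additional relations. -/
inductive Rel (R : ∀ ⦃a b a' b' : M⦄, Term s t a b → Term s t a' b' → Prop) :
    ∀ {a b a' b' : M}, Term s t a b → Term s t a' b' → Prop
  | extra {a b a' b' : M} {f : Term s t a b} {g : Term s t a' b'} : R f g → Rel R f g
  | refl {a b : M} (f : Term s t a b) : Rel R f f
  | symm {a b a' b' : M} {f : Term s t a b} {g : Term s t a' b'} : Rel R f g → Rel R g f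
  | trans {a b a' b' a'' b'' : M} {f : Term s t a b} {g : Term s t a' b'}
    {h : Term s t a'' b''} : Rel R f g → Rel R g h → Rel R f h
  | comp_congr {a b c a' b' c' : M} {f : Term s t a b} {g : Term s t b c} {f' : Term s t a' b'}
    {g' : Term s t b' c'} : Rel R f f' → Rel R g g' → Rel R (f.comp g) (f'.comp g')
  | add_congr {a b c d a' b' c' d' : M} {f : Term s t a b} {g : Term s t c d}
    {f' : Term s t a' b'} {g' : Term s t c' d'} :
    Rel R f f' → Rel R g g' → Rel R (f.add g) (f'.add g')
  | id_comp {a b : M} (f : Term s t a b) : Rel R ((Term.id a).comp f) f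
  | comp_id {a b : M} (f : Term s t a b) : Rel R (f.comp (Term.id b)) f
  | comp_assoc {a b c d : M} (f : Term s t a b) (g : Term s t b c) (h : Term s t c d) :
    Rel R ((f.comp g).comp h) (f.comp (g.comp h))
  | add_id (a b : M) : Rel R ((Term.id a).add (Term.id b)) (Term.id (a + b))
  | add_comp {a b c a' b' c' : M} (f : Term s t a b) (g : Term s t b c) (f' : Term s t a' b')
    (g' : Term s t b' c') : Rel R ((f.comp g).add (f'.comp g')) ((f.add f').comp (g.add g'))
  | add_assoc {a b a' b' a'' b'' : M} (f : Term s t a b) (g : Term s t a' b')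
    (h : Term s t a'' b'') : Rel R ((f.add g).add h) (f.add (g.add h))
  | zero_add {a b : M} (f : Term s t a b) : Rel R ((Term.id 0).add f) f
  | add_comm {a b a' b' : M} (f : Term s t a b) (g : Term s t a' b') :
    Rel R (f.add g) (g.add f)

variable {s t} {R : ∀ ⦃a b a' b' : M⦄, Term s t a b → Term s t a' b' → Prop}

theorem Rel.ends (hR : ∀ {a b a' b' : M} (f : Term s t a b) (g : Term s t a' b'),
    R f g → a = a' ∧ b = b') {a b a' b' : M} {f : Term s t a b} {g : Term s t a' b'}
    (h : Rel s t R f g) : a = a' ∧ b = b' := by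
  induction h with
  | extra h => exact hR _ _ h
  | refl => exact ⟨rfl, rfl⟩
  | symm _ ih => exact ⟨ih.1.symm, ih.2.symm⟩
  | trans _ _ ih ih' => exact ⟨ih.1.trans ih'.1, ih.2.trans ih'.2⟩
  | comp_congr _ _ ih ih' => exact ⟨ih.1, ih'.2⟩
  | add_congr _ _ ih ih' => exact ⟨by rw [ih.1, ih'.1], by rw [ih.2, ih'.2]⟩
  | id_comp | comp_id | comp_assoc | add_id | add_comp => exact ⟨rfl, rfl⟩
  | add_assoc => exact ⟨_root_.add_assoc _ _ _, _root_.add_assoc _ _ _⟩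
  | zero_add => exact ⟨_root_.zero_add _, _root_.zero_add _⟩
  | add_comm => exact ⟨_root_.add_comm _ _, _root_.add_comm _ _⟩

variable (s t) in
/-- Generated morphisms from `a` to `b`, up to the equivalence relation. -/
def relSetoid (R : ∀ ⦃a b a' b' : M⦄, Term s t a b → Term s t a' b' → Prop) (a b : M) :
    Setoid (Term s t a b) where
  r f g := Rel s t R f g
  iseqv := ⟨.refl, .symm, .trans⟩

theorem mk_heq (hR : ∀ {a b a' b' : M} (f : Term s t a b) (g : Term s t a' b'),
    R f g → a = a' ∧ b = b') {a b a' b' : M} {f : Term s t a b} {g : Term s t a' b'}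
    (h : Rel s t R f g) :
    HEq (Quotient.mk (relSetoid s t R a b) f) (Quotient.mk (relSetoid s t R a' b') g) := by
  obtain ⟨rfl, rfl⟩ := h.ends hR
  exact heq_of_eq (Quotient.sound h)

variable (s t R) in
/-- The commutative monoidal category with the commutative monoid `M` of objects and with
morphisms presented by generators `g : s g ⟶ t g` and relations `R`. -/
def presented (hR : ∀ {a b a' b' : M} (f : Term s t a b) (g : Term s t a' b'),
    R f g → a = a' ∧ b = b') : CMC.{u} where
  Ob := M
  cat :=
    { Hom := fun a b => Quotient (relSetoid s t R a b)
      id := fun a => Quotient.mk _ (Term.id a)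
      comp := fun f g => Quotient.map₂ Term.comp (fun _ _ h _ _ h' => Rel.comp_congr h h') f g
      id_comp := fun f => Quotient.inductionOn f fun f => Quotient.sound (Rel.id_comp f)
      comp_id := fun f => Quotient.inductionOn f fun f => Quotient.sound (Rel.comp_id f)
      assoc := fun f g h => Quotient.inductionOn₃ f g h fun f g h =>
        Quotient.sound (Rel.comp_assoc f g h) }
  tensor f g := Quotient.map₂ Term.add (fun _ _ h _ _ h' => Rel.add_congr h h') f g
  tensor_id a b := Quotient.sound (Rel.add_id a b)
  tensor_comp f g f' g' := Quotient.inductionOn₂ f g fun f g =>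
    Quotient.inductionOn₂ f' g' fun f' g' => Quotient.sound (Rel.add_comp f g f' g')
  tensor_assoc f g h := Quotient.inductionOn₃ f g h fun f g h => mk_heq hR (Rel.add_assoc f g h)
  zero_tensor f := Quotient.inductionOn f fun f => mk_heq hR (Rel.zero_add f)
  tensor_comm f g := Quotient.inductionOn₂ f g fun f g => mk_heq hR (Rel.add_comm f g)

variable (hR : ∀ {a b a' b' : M} (f : Term s t a b) (g : Term s t a' b'),
    R f g → a = a' ∧ b = b')

/-- The morphism of a presented commutative monoidal category represented by a term. -/
def presentedMk {a b : M} (f : Term s t a b) :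
    @Quiver.Hom (presented s t R hR).Ob (presented s t R hR).cat.toQuiver a b := Quotient.mk (relSetoid s t R a b) f

theorem presentedMk_same {a b a' b' : M} {f : Term s t a b} {g : Term s t a' b'}
    (h : Rel s t R f g) : Same (C := presented s t R hR) (presentedMk hR f) (presentedMk hR g) :=
  .of_heq (h.ends hR).1 (h.ends hR).2 (mk_heq hR h)

variable {C : CMC.{u}} (φ : M →+ C.Ob) (γ : ∀ g, φ (s g) ⟶ φ (t g))

/-- Evaluation of terms in a commutative monoidal category. -/
def eval : ∀ {a b : M}, Term s t a b → (φ a ⟶ φ b)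
  | _, _, .gen g => γ g
  | _, _, .id _ => 𝟙 _
  | _, _, .comp f g => eval f ≫ eval g
  | _, _, .add f g => cast (by rw [map_add, map_add]) (C.tensor (eval f) (eval g))

theorem eval_add {a b a' b' : M} (f : Term s t a b) (g : Term s t a' b') :
    Same (eval φ γ (f.add g)) (C.tensor (eval φ γ f) (eval φ γ g)) :=
  same_cast (map_add _ _ _).symm (map_add _ _ _).symm _

theorem eval_same (h : ∀ {a b a' b' : M} (f : Term s t a b) (g : Term s t a' b'),
    R f g → Same (eval φ γ f) (eval φ γ g)) {a b a' b' : M} {f : Term s t a b}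
    {g : Term s t a' b'} (hfg : Rel s t R f g) : Same (eval φ γ f) (eval φ γ g) := by
  induction hfg with
  | extra hh => exact h _ _ hh
  | refl => exact .refl _
  | symm _ ih => exact ih.symm
  | trans _ _ ih ih' => exact ih.trans ih'
  | comp_congr _ _ ih ih' => exact ih.comp ih'
  | add_congr _ _ ih ih' =>
    exact (eval_add ..).trans ((ih.tensor ih').trans (eval_add ..).symm)
  | id_comp => exact .of_eq (Category.id_comp _)
  | comp_id => exact .of_eq (Category.comp_id _)
  | comp_assoc => exact .of_eq (Category.assoc _ _ _)
  | add_id a b =>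
    exact (eval_add ..).trans ((Same.of_eq (C.tensor_id _ _)).trans (same_id (map_add φ a b).symm))
  | add_comp f g f' g' =>
    exact (eval_add ..).trans ((Same.of_eq (C.tensor_comp _ _ _ _)).trans
      ((eval_add ..).comp (eval_add ..)).symm)
  | add_assoc f g k =>
    refine (eval_add ..).trans (((eval_add ..).tensor (.refl _)).trans ?_)
    exact (same_assoc _ _ _).trans
      ((Same.tensor (.refl _) (eval_add ..)).symm.trans (eval_add ..).symm)
  | zero_add f =>
    exact (eval_add ..).trans (((same_id (map_zero φ)).tensor (.refl _)).trans (same_zero _))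
  | add_comm f g => exact (eval_add ..).trans ((same_comm _ _).trans (eval_add ..).symm)

/-- The universal property of a presented commutative monoidal category. -/
def presentedDesc (h : ∀ {a b a' b' : M} (f : Term s t a b) (g : Term s t a' b'),
    R f g → Same (eval φ γ f) (eval φ γ g)) : presented s t R hR ⟶ C where
  obj := φ
  map {a b} f := Quotient.lift (s := relSetoid s t R a b) (eval φ γ)
    (fun _ _ hfg => (eval_same φ γ h hfg).eq) f
  map_id _ := rfl
  map_comp f g := Quotient.inductionOn₂ f g fun _ _ => rfl
  map_tensor f g := Quotient.inductionOn₂ f g fun f g => (eval_add φ γ f g).heq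

theorem presented_hom_same {F F' : presented s t R hR ⟶ C} (h₁ : ∀ a : M, F.obj a = F'.obj a)
    (h₂ : ∀ g, Same (F.map (presentedMk hR (Term.gen g))) (F'.map (presentedMk hR (Term.gen g))))
    {a b : M} (f : Term s t a b) :
    Same (F.map (presentedMk hR f)) (F'.map (presentedMk hR f)) := by
  induction f with
  | gen g => exact h₂ g
  | id a =>
    exact (Same.of_eq (F.map_id a)).trans
      ((same_id (h₁ a)).trans (Same.of_eq (F'.map_id a)).symm)
  | comp f g ih ih' =>
    exact (Same.of_eq (F.map_comp (presentedMk hR f) (presentedMk hR g))).trans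
      ((ih.comp ih').trans (Same.of_eq (F'.map_comp _ _)).symm)
  | add f g ih ih' =>
    exact (same_map_tensor F (presentedMk hR f) (presentedMk hR g)).trans
      ((ih.tensor ih').trans (same_map_tensor F' _ _).symm)

theorem presented_hom_ext {F F' : presented s t R hR ⟶ C} (h₁ : ∀ a : M, F.obj a = F'.obj a)
    (h₂ : ∀ g, Same (F.map (presentedMk hR (Term.gen g))) (F'.map (presentedMk hR (Term.gen g)))) :
    F = F' :=
  hom_ext h₁ fun f => Quotient.inductionOn f fun f => presented_hom_same hR h₁ h₂ f

end presentation

/-! #### The free commutative monoidal category on a Petri net -/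

/-- No additional relations. -/
def noRel {M G : Type u} [AddCommMonoid M] (s t : G → M) ⦃a b a' b' : M⦄ (_ : Term s t a b)
    (_ : Term s t a' b') : Prop := False

/-- The free commutative monoidal category on a Petri net: its objects form the free commutative
monoid on the places and its morphisms are generated by the transitions. -/
def free (P : PetriNet.{u}) : CMC.{u} :=
  presented P.src P.tgt (noRel P.src P.tgt) (fun _ _ h => h.elim)

/-- The morphism of the free commutative monoidal category given by a transition. -/
def freeGen (P : PetriNet.{u}) (τ : P.T) :
    @Quiver.Hom (free P).Ob (free P).cat.toQuiver (P.src τ) (P.tgt τ) :=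
  presentedMk (fun _ _ h => h.elim) (Term.gen τ)

/-- The universal property of `free P`: a strict monoidal functor is determined by a homomorphism
on objects and by the images of the transitions. -/
def freeDesc (P : PetriNet.{u}) {C : CMC.{u}} (φ : Multiset P.S →+ C.Ob)
    (γ : ∀ τ, φ (P.src τ) ⟶ φ (P.tgt τ)) : free P ⟶ C :=
  presentedDesc (fun _ _ h => h.elim) φ γ (fun _ _ h => h.elim)

theorem freeDesc_gen (P : PetriNet.{u}) {C : CMC.{u}} (φ : Multiset P.S →+ C.Ob)
    (γ : ∀ τ, φ (P.src τ) ⟶ φ (P.tgt τ)) (τ : P.T) :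
    (freeDesc P φ γ).map (freeGen P τ) = γ τ := rfl

theorem free_hom_ext {P : PetriNet.{u}} {C : CMC.{u}} {F F' : free P ⟶ C}
    (h₁ : ∀ x : P.S, F.obj ({x} : Multiset P.S) = F'.obj ({x} : Multiset P.S))
    (h₂ : ∀ τ, Same (F.map (freeGen P τ)) (F'.map (freeGen P τ))) : F = F' :=
  presented_hom_ext (R := noRel P.src P.tgt) (fun _ _ h => h.elim) (fun a => DFunLike.congr_fun (Multiset.addHom_ext
    (f := (F.obj : Multiset P.S →+ C.Ob)) (g := (F'.obj : Multiset P.S →+ C.Ob)) h₁) a) h₂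

/-- The action of the free functor on a morphism of Petri nets. -/
def freeMap {P Q : PetriNet.{u}} (h : P ⟶ Q) : free P ⟶ free Q :=
  freeDesc P (Multiset.mapAddMonoidHom h.onS) fun τ =>
    cast (congrArg₂ (fun x y : (free Q).Ob => (x ⟶ y)) (h.src_comm τ).symm (h.tgt_comm τ).symm)
      (freeGen Q (h.onT τ))

theorem freeMap_gen {P Q : PetriNet.{u}} (h : P ⟶ Q) (τ : P.T) :
    Same ((freeMap h).map (freeGen P τ)) (freeGen Q (h.onT τ)) :=
  same_cast (C := free Q) (h.src_comm τ).symm (h.tgt_comm τ).symm _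

theorem freeMap_single {P Q : PetriNet.{u}} (h : P ⟶ Q) (x : P.S) :
    (freeMap h).obj ({x} : Multiset P.S) = ({h.onS x} : Multiset Q.S) :=
  Multiset.map_singleton _ _

/-- The free commutative monoidal category functor. -/
def F : PetriNet.{u} ⥤ CMC.{u} where
  obj := free
  map := freeMap
  map_id P := free_hom_ext (fun x => freeMap_single (𝟙 P) x) (fun τ => freeMap_gen (𝟙 P) τ)
  map_comp f g := free_hom_ext
    (fun x => (freeMap_single (f ≫ g) x).trans
      ((congrArg (freeMap g).obj (freeMap_single f x)).trans (freeMap_single g (f.onS x))).symm)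
    (fun τ => (freeMap_gen (f ≫ g) τ).trans
      (((freeMap_gen f τ).map (freeMap g)).trans (freeMap_gen g (f.onT τ))).symm)

/-- A transition of the underlying Petri net of a commutative monoidal category. -/
structure UnderlyingTransition (C : CMC.{u}) : Type u where
  /-- the source multiset -/
  dom : Multiset C.Ob
  /-- the target multiset -/
  cod : Multiset C.Ob
  /-- the morphism -/
  hom : dom.sum ⟶ cod.sum

theorem UnderlyingTransition.ext' {C : CMC.{u}} {x y : UnderlyingTransition C}
    (h₁ : x.dom = y.dom) (h₂ : x.cod = y.cod) (h₃ : Same x.hom y.hom) : x = y := by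
  obtain ⟨a, b, f⟩ := x
  obtain ⟨a', b', f'⟩ := y
  obtain rfl : a = a' := h₁
  obtain rfl : b = b' := h₂
  obtain rfl : f = f' := h₃.eq
  rfl

/-- The underlying Petri net of a commutative monoidal category. -/
def underlying (C : CMC.{u}) : PetriNet.{u} :=
  ⟨C.Ob, UnderlyingTransition C, UnderlyingTransition.dom, UnderlyingTransition.cod⟩

/-- The counit of the adjunction. -/
def counit (C : CMC.{u}) : free (underlying C) ⟶ C :=
  freeDesc (underlying C) (Multiset.sumAddMonoidHom : Multiset C.Ob →+ C.Ob) (fun τ => UnderlyingTransition.hom τ)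

theorem sum_map_obj {P : PetriNet.{u}} {C : CMC.{u}} (h : free P ⟶ C) (m : Multiset P.S) :
    (m.map fun x => h.obj ({x} : Multiset P.S)).sum = h.obj m := by
  have := DFunLike.congr_fun (Multiset.addHom_ext
    (f := Multiset.sumAddMonoidHom.comp
      (Multiset.mapAddMonoidHom fun x : P.S => h.obj ({x} : Multiset P.S)))
    (g := (h.obj : Multiset P.S →+ C.Ob)) (fun x => by
      change (({x} : Multiset P.S).map fun x => h.obj ({x} : Multiset P.S)).sum = _
      rw [Multiset.map_singleton, Multiset.sum_singleton]
      rfl)) m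
  exact this

/-- The transpose of a strict monoidal functor out of a free commutative monoidal category. -/
def transpose {P : PetriNet.{u}} {C : CMC.{u}} (h : free P ⟶ C) : P ⟶ underlying C where
  onS x := h.obj ({x} : Multiset P.S)
  onT τ :=
    { dom := (P.src τ).map fun x => h.obj ({x} : Multiset P.S)
      cod := (P.tgt τ).map fun x => h.obj ({x} : Multiset P.S)
      hom := cast (congrArg₂ (fun x y : C.Ob => (x ⟶ y)) (sum_map_obj h (P.src τ)).symm
        (sum_map_obj h (P.tgt τ)).symm) (h.map (freeGen P τ)) }
  src_comm _ := rfl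
  tgt_comm _ := rfl

theorem transpose_hom {P : PetriNet.{u}} {C : CMC.{u}} (h : free P ⟶ C) (τ : P.T) :
    Same (UnderlyingTransition.hom ((transpose h).onT τ)) (h.map (freeGen P τ)) :=
  same_cast (sum_map_obj h _).symm (sum_map_obj h _).symm _

theorem freeMap_counit_single {P : PetriNet.{u}} {C : CMC.{u}} (m : P ⟶ underlying C) (x : P.S) :
    (freeMap m ≫ counit C).obj ({x} : Multiset P.S) = m.onS x :=
  (congrArg (counit C).obj (freeMap_single m x)).trans (Multiset.sum_singleton _)

theorem freeMap_counit_gen {P : PetriNet.{u}} {C : CMC.{u}} (m : P ⟶ underlying C) (τ : P.T) :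
    Same ((freeMap m ≫ counit C).map (freeGen P τ)) (UnderlyingTransition.hom (m.onT τ)) :=
  (freeMap_gen m τ).map (counit C)

theorem transpose_counit {P : PetriNet.{u}} {C : CMC.{u}} (h : free P ⟶ C) :
    freeMap (transpose h) ≫ counit C = h :=
  free_hom_ext (fun x => freeMap_counit_single (transpose h) x)
    (fun τ => (freeMap_counit_gen (transpose h) τ).trans (transpose_hom h τ))

theorem transpose_unique {P : PetriNet.{u}} {C : CMC.{u}} (m : P ⟶ underlying C) :
    m = transpose (freeMap m ≫ counit C) := by
  have hS : m.onS = (transpose (freeMap m ≫ counit C)).onS :=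
    funext fun x => (freeMap_counit_single m x).symm
  refine PetriNet.hom_ext (fun τ => UnderlyingTransition.ext' ?_ ?_ ?_) (fun x => congrFun hS x)
  · refine (m.src_comm τ).symm.trans ?_
    rw [hS]
    exact PetriNet.Hom.src_comm _ τ
  · refine (m.tgt_comm τ).symm.trans ?_
    rw [hS]
    exact PetriNet.Hom.tgt_comm _ τ
  · exact ((transpose_hom _ τ).trans (freeMap_counit_gen m τ)).symm

instance : F.{u}.IsLeftAdjoint := by
  have : ∀ C : CMC.{u}, HasTerminal (CostructuredArrow F.{u} C) := fun C => by
    refine IsTerminal.hasTerminal (X := CostructuredArrow.mk (Y := underlying C) (counit C)) ?_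
    refine IsTerminal.ofUniqueHom
      (fun h => CostructuredArrow.homMk (transpose h.hom) (transpose_counit h.hom)) ?_
    intro h m
    ext1
    refine (transpose_unique m.left).trans (congrArg transpose ?_)
    exact CostructuredArrow.w m
  exact isLeftAdjoint_of_costructuredArrowTerminals F

/-! #### Colimits of commutative monoidal categories -/

section colimits

variable {J : Type u} [Category.{u} J] (D : J ⥤ CMC.{u})

/-- Relations presenting the commutative monoid of objects of a colimit. -/
inductive ObRel : Multiset (Σ j, (D.obj j).Ob) → Multiset (Σ j, (D.obj j).Ob) → Prop
  | zero (j : J) : ObRel {⟨j, 0⟩} 0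
  | add (j : J) (a b : (D.obj j).Ob) : ObRel {⟨j, a + b⟩} ({⟨j, a⟩} + {⟨j, b⟩})
  | map {j j' : J} (u : j ⟶ j') (a : (D.obj j).Ob) : ObRel {⟨j', (D.map u).obj a⟩} {⟨j, a⟩}

/-- The commutative monoid of objects of a colimit. -/
abbrev ColimOb : Type u := (addConGen (ObRel D)).Quotient

/-- The coprojections on objects. -/
def ιOb (j : J) : (D.obj j).Ob →+ ColimOb D where
  toFun a := ((({⟨j, a⟩} : Multiset (Σ j, (D.obj j).Ob))) : ColimOb D)
  map_zero' := (AddCon.eq _).2 (AddConGen.Rel.of _ _ (ObRel.zero j))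
  map_add' a b := (AddCon.eq _).2 (AddConGen.Rel.of _ _ (ObRel.add j a b))

theorem ιOb_map {j j' : J} (u : j ⟶ j') (a : (D.obj j).Ob) :
    ιOb D j' ((D.map u).obj a) = ιOb D j a :=
  (AddCon.eq _).2 (AddConGen.Rel.of _ _ (ObRel.map u a))

/-- Generating morphisms of a colimit. -/
structure ColimGen : Type u where
  /-- the index -/
  j : J
  /-- the source -/
  a : (D.obj j).Ob
  /-- the target -/
  b : (D.obj j).Ob
  /-- the morphism -/
  f : a ⟶ b

/-- Sources of generating morphisms. -/
def genSrc (g : ColimGen D) : ColimOb D := ιOb D g.j g.a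
/-- Targets of generating morphisms. -/
def genTgt (g : ColimGen D) : ColimOb D := ιOb D g.j g.b

/-- Generating morphisms as terms. -/
def genTerm (j : J) {a b : (D.obj j).Ob} (f : a ⟶ b) :
    Term (genSrc D) (genTgt D) (ιOb D j a) (ιOb D j b) :=
  Term.gen (⟨j, a, b, f⟩ : ColimGen D)

/-- Relations presenting the morphisms of a colimit. -/
inductive HomRel : ∀ ⦃a b a' b' : ColimOb D⦄, Term (genSrc D) (genTgt D) a b →
    Term (genSrc D) (genTgt D) a' b' → Prop
  | id (j : J) (a : (D.obj j).Ob) : HomRel (genTerm D j (𝟙 a)) (Term.id (ιOb D j a))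
  | comp (j : J) {a b c : (D.obj j).Ob} (f : a ⟶ b) (g : b ⟶ c) :
    HomRel (genTerm D j (f ≫ g)) ((genTerm D j f).comp (genTerm D j g))
  | tensor (j : J) {a b a' b' : (D.obj j).Ob} (f : a ⟶ b) (g : a' ⟶ b') :
    HomRel (genTerm D j ((D.obj j).tensor f g)) ((genTerm D j f).add (genTerm D j g))
  | map {j j' : J} (u : j ⟶ j') {a b : (D.obj j).Ob} (f : a ⟶ b) :
    HomRel (genTerm D j' ((D.map u).map f)) (genTerm D j f)

theorem HomRel.ends {a b a' b' : ColimOb D} (f : Term (genSrc D) (genTgt D) a b)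
    (g : Term (genSrc D) (genTgt D) a' b') (h : HomRel D f g) : a = a' ∧ b = b' := by
  cases h with
  | id | comp => exact ⟨rfl, rfl⟩
  | tensor => exact ⟨map_add _ _ _, map_add _ _ _⟩
  | map u => exact ⟨ιOb_map D u _, ιOb_map D u _⟩

/-- The colimit of a diagram of commutative monoidal categories. -/
def colim : CMC.{u} := presented (genSrc D) (genTgt D) (HomRel D) (HomRel.ends D)

/-- The colimit cocone of a diagram of commutative monoidal categories. -/
def colimCocone : Cocone D where
  pt := colim D
  ι :=
    { app := fun j =>
        { obj := ιOb D j
          map := fun f => presentedMk (HomRel.ends D) (genTerm D j f)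
          map_id := fun a => Quotient.sound (Rel.extra (HomRel.id j a))
          map_comp := fun f g => Quotient.sound (Rel.extra (HomRel.comp j f g))
          map_tensor := fun f g => mk_heq (HomRel.ends D) (Rel.extra (HomRel.tensor j f g)) }
      naturality := fun _ _ u => hom_ext (fun a => ιOb_map D u a)
        (fun f => presentedMk_same (HomRel.ends D) (Rel.extra (HomRel.map u f))) }

variable {D} (c : Cocone D)

/-- The map out of the colimit, on objects. -/
def descOb : ColimOb D →+ c.pt.Ob :=
  (addConGen (ObRel D)).lift
    (Multiset.sumAddMonoidHom.comp (Multiset.mapAddMonoidHom fun x => (c.ι.app x.1).obj x.2))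
    (AddCon.addConGen_le.2 fun x y h => by
      cases h with
      | zero j => simp [AddCon.ker_rel]
      | add j a b => simp [AddCon.ker_rel]
      | map u a =>
        simp only [AddCon.ker_rel, AddMonoidHom.comp_apply, Multiset.coe_mapAddMonoidHom,
          Multiset.map_singleton, Multiset.coe_sumAddMonoidHom, Multiset.sum_singleton]
        exact congrArg (fun F => Hom.obj F a) (c.w u))

theorem descOb_ι (j : J) (a : (D.obj j).Ob) : descOb c (ιOb D j a) = (c.ι.app j).obj a := by
  refine (AddCon.lift_coe _ _).trans ?_
  simp

/-- The map out of the colimit, on generating morphisms. -/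
def descGen (g : ColimGen D) : descOb c (genSrc D g) ⟶ descOb c (genTgt D g) :=
  cast (by rw [genSrc, genTgt, descOb_ι, descOb_ι]) ((c.ι.app g.j).map g.f)

theorem descGen_same (g : ColimGen D) : Same (descGen c g) ((c.ι.app g.j).map g.f) :=
  same_cast (descOb_ι c _ _).symm (descOb_ι c _ _).symm _

theorem eval_genTerm (j : J) {a b : (D.obj j).Ob} (f : a ⟶ b) :
    Same (eval (descOb c) (descGen c) (genTerm D j f)) ((c.ι.app j).map f) :=
  descGen_same c _

theorem eval_homRel {a b a' b' : ColimOb D} (f : Term (genSrc D) (genTgt D) a b)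
    (g : Term (genSrc D) (genTgt D) a' b') (h : HomRel D f g) :
    Same (eval (descOb c) (descGen c) f) (eval (descOb c) (descGen c) g) := by
  cases h with
  | id j a =>
    exact (eval_genTerm c j _).trans ((Same.of_eq (Hom.map_id _ _)).trans
      (same_id (descOb_ι c j a).symm))
  | comp j f g =>
    exact (eval_genTerm c j _).trans ((Same.of_eq (Hom.map_comp _ _ _)).trans
      ((eval_genTerm c j f).comp (eval_genTerm c j g)).symm)
  | tensor j f g =>
    exact (eval_genTerm c j _).trans ((same_map_tensor (c.ι.app j) f g).trans
      ((eval_add _ _ _ _).trans ((eval_genTerm c j f).tensor (eval_genTerm c j g))).symm)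
  | map u f =>
    refine (eval_genTerm c _ _).trans (Same.trans ?_ (eval_genTerm c _ f).symm)
    rw [← c.w u]
    exact .refl _

variable (D) in
/-- The universal property of the colimit. -/
def isColimitColimCocone : IsColimit (colimCocone D) where
  desc c := presentedDesc (HomRel.ends D) (descOb c) (descGen c) (eval_homRel c)
  fac c j := hom_ext (fun a => descOb_ι c j a) (fun f => eval_genTerm c j f)
  uniq c m h := presented_hom_ext (HomRel.ends D)
    (fun a => by
      refine DFunLike.congr_fun (?_ : (m.obj : ColimOb D →+ c.pt.Ob) = descOb c) a
      refine AddCon.hom_ext (Multiset.addHom_ext fun x => ?_)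
      exact (congrArg (fun F => Hom.obj F x.2) (h x.1)).trans (descOb_ι c x.1 x.2).symm)
    (fun g => by
      refine Same.trans ?_ (descGen_same c g).symm
      rw [← h g.j]
      exact .refl _)

end colimits

instance : HasColimits CMC.{u} where
  has_colimits_of_shape _ _ :=
    { has_colimit := fun D => ⟨⟨⟨colimCocone D, isColimitColimCocone D⟩⟩⟩ }

end CMC

/-! ### Double functors -/

/-- The underlying functors of a double functor: a functor `F0` on the categories of objects and a
functor `F1` on the categories of arrows, given by `hor` on horizontal 1-cells and by `sq` on
2-morphisms, with `S ∘ F1 = F0 ∘ S` and `T ∘ F1 = F0 ∘ T`. -/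
structure DoubleFunctorData (C : DoubleCategory.{v₀, u₀, v₁, u₁})
    (D : DoubleCategory.{v₀', u₀', v₁', u₁'}) where
  /-- the functor on objects and vertical 1-morphisms -/
  F0 : C.Obj ⥤ D.Obj
  /-- the action on horizontal 1-cells -/
  hor : ∀ {a b : C.Obj}, C.Hor a b → D.Hor (F0.obj a) (F0.obj b)
  /-- the action on 2-morphisms -/
  sq : ∀ {a b a' b' : C.Obj} {M : C.Hor a b} {N : C.Hor a' b'},
    (HCell.of M ⟶ HCell.of N) → (HCell.of (hor M) ⟶ HCell.of (hor N))
  S_sq : ∀ {a b a' b' : C.Obj} {M : C.Hor a b} {N : C.Hor a' b'} (α : HCell.of M ⟶ HCell.of N),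
    D.S (sq α) = F0.map (C.S α)
  T_sq : ∀ {a b a' b' : C.Obj} {M : C.Hor a b} {N : C.Hor a' b'} (α : HCell.of M ⟶ HCell.of N),
    D.T (sq α) = F0.map (C.T α)
  sq_id : ∀ {a b : C.Obj} (M : C.Hor a b), sq (𝟙 (HCell.of M)) = 𝟙 (HCell.of (hor M))
  sq_comp : ∀ {a b a' b' a'' b'' : C.Obj} {M : C.Hor a b} {N : C.Hor a' b'} {P : C.Hor a'' b''}
    (α : HCell.of M ⟶ HCell.of N) (β : HCell.of N ⟶ HCell.of P), sq (α ≫ β) = sq α ≫ sq β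

/-- A (strong) double functor, with globular composition and identity comparisons. -/
structure DoubleFunctor (C : DoubleCategory.{v₀, u₀, v₁, u₁})
    (D : DoubleCategory.{v₀', u₀', v₁', u₁'}) extends DoubleFunctorData C D where
  /-- the composition comparison -/
  compComparison : ∀ {a b c : C.Obj} (M : C.Hor a b) (N : C.Hor b c),
    HCell.of (D.comp (hor M) (hor N)) ≅ HCell.of (hor (C.comp M N))
  S_compComparison : ∀ {a b c : C.Obj} (M : C.Hor a b) (N : C.Hor b c),
    D.S (compComparison M N).hom = 𝟙 (F0.obj a)
  T_compComparison : ∀ {a b c : C.Obj} (M : C.Hor a b) (N : C.Hor b c),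
    D.T (compComparison M N).hom = 𝟙 (F0.obj c)
  compComparison_natural : ∀ {a b c a' b' c' : C.Obj} {M : C.Hor a b} {N : C.Hor b c}
    {M' : C.Hor a' b'} {N' : C.Hor b' c'} (α : HCell.of M ⟶ HCell.of M')
    (β : HCell.of N ⟶ HCell.of N') (h : C.T α = C.S β),
    D.hcomp (sq α) (sq β) ((T_sq α).trans ((congrArg F0.map h).trans (S_sq β).symm)) ≫
        (compComparison M' N').hom =
      (compComparison M N).hom ≫ sq (C.hcomp α β h)
  /-- the identity comparison -/
  idComparison : ∀ a : C.Obj, HCell.of (D.U (F0.obj a)) ≅ HCell.of (hor (C.U a))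
  S_idComparison : ∀ a : C.Obj, D.S (idComparison a).hom = 𝟙 (F0.obj a)
  T_idComparison : ∀ a : C.Obj, D.T (idComparison a).hom = 𝟙 (F0.obj a)
  idComparison_natural : ∀ {a b : C.Obj} (f : a ⟶ b),
    D.Umap (F0.map f) ≫ (idComparison b).hom = (idComparison a).hom ≫ sq (C.Umap f)
  /-- compatibility with the associator -/
  compComparison_assoc : ∀ {a b c d : C.Obj} (M : C.Hor a b) (N : C.Hor b c) (P : C.Hor c d),
    D.hcomp (compComparison M N).hom (𝟙 (HCell.of (hor P)))
          ((T_compComparison M N).trans (D.S_id (HCell.of (hor P))).symm) ≫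
        (compComparison (C.comp M N) P).hom ≫ sq (C.assoc M N P).hom =
      (D.assoc (hor M) (hor N) (hor P)).hom ≫
        D.hcomp (𝟙 (HCell.of (hor M))) (compComparison N P).hom
          ((D.T_id (HCell.of (hor M))).trans (S_compComparison N P).symm) ≫
        (compComparison M (C.comp N P)).hom
  /-- compatibility with the left unitor -/
  compComparison_leftUnitor : ∀ {a b : C.Obj} (M : C.Hor a b),
    D.hcomp (idComparison a).hom (𝟙 (HCell.of (hor M)))
          ((T_idComparison a).trans (D.S_id (HCell.of (hor M))).symm) ≫
        (compComparison (C.U a) M).hom ≫ sq (C.leftUnitor M).hom =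
      (D.leftUnitor (hor M)).hom
  /-- compatibility with the right unitor -/
  compComparison_rightUnitor : ∀ {a b : C.Obj} (M : C.Hor a b),
    D.hcomp (𝟙 (HCell.of (hor M))) (idComparison b).hom
          ((D.T_id (HCell.of (hor M))).trans (S_idComparison b).symm) ≫
        (compComparison M (C.U b)).hom ≫ sq (C.rightUnitor M).hom =
      (D.rightUnitor (hor M)).hom

open Functor.LaxMonoidal (μ ε) in
/-- A (strong) monoidal double functor: a double functor such that `F0` and `F1` are monoidal
functors, `S ∘ F1 = F0 ∘ S` and `T ∘ F1 = F0 ∘ T` hold as equations between monoidal functors, and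
the composition and identity comparisons are monoidal natural transformations.  The monoidal
structure of `F1` is given by `tensorComparison` and `tensorUnitComparison`. -/
structure MonoidalDoubleFunctor (C : MonoidalDoubleCategory.{v₀, u₀, v₁, u₁})
    (D : MonoidalDoubleCategory.{v₀', u₀', v₁', u₁'}) extends
    DoubleFunctor C.toDoubleCategory D.toDoubleCategory where
  [mon₀ : F0.Monoidal]
  /-- the tensor comparison of `F1` -/
  tensorComparison : ∀ {a b c d : C.Obj} (M : C.Hor a b) (N : C.Hor c d),
    HCell.of (D.tensor (hor M) (hor N)) ≅ HCell.of (hor (C.tensor M N))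
  S_tensorComparison : ∀ {a b c d : C.Obj} (M : C.Hor a b) (N : C.Hor c d),
    D.S (tensorComparison M N).hom = μ F0 a c
  T_tensorComparison : ∀ {a b c d : C.Obj} (M : C.Hor a b) (N : C.Hor c d),
    D.T (tensorComparison M N).hom = μ F0 b d
  tensorComparison_natural : ∀ {a b c d a' b' c' d' : C.Obj} {M : C.Hor a b} {N : C.Hor c d}
    {M' : C.Hor a' b'} {N' : C.Hor c' d'} (α : HCell.of M ⟶ HCell.of M')
    (β : HCell.of N ⟶ HCell.of N'),
    D.tensorMap (sq α) (sq β) ≫ (tensorComparison M' N').hom =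
      (tensorComparison M N).hom ≫ sq (C.tensorMap α β)
  /-- the unit comparison of `F1` -/
  tensorUnitComparison : HCell.of (D.U (𝟙_ D.Obj)) ≅ HCell.of (hor (C.U (𝟙_ C.Obj)))
  S_tensorUnitComparison : D.S tensorUnitComparison.hom = ε F0
  T_tensorUnitComparison : D.T tensorUnitComparison.hom = ε F0
  tensorComparison_assoc : ∀ {a b c d e f : C.Obj} (M : C.Hor a b) (N : C.Hor c d)
    (P : C.Hor e f),
    D.tensorMap (tensorComparison M N).hom (𝟙 (HCell.of (hor P))) ≫
        (tensorComparison (C.tensor M N) P).hom ≫ sq (C.tensorAssoc M N P).hom =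
      (D.tensorAssoc (hor M) (hor N) (hor P)).hom ≫
        D.tensorMap (𝟙 (HCell.of (hor M))) (tensorComparison N P).hom ≫
        (tensorComparison M (C.tensor N P)).hom
  tensorComparison_leftUnitor : ∀ {a b : C.Obj} (M : C.Hor a b),
    D.tensorMap tensorUnitComparison.hom (𝟙 (HCell.of (hor M))) ≫
        (tensorComparison (C.U (𝟙_ C.Obj)) M).hom ≫ sq (C.tensorLeftUnitor M).hom =
      (D.tensorLeftUnitor (hor M)).hom
  tensorComparison_rightUnitor : ∀ {a b : C.Obj} (M : C.Hor a b),
    D.tensorMap (𝟙 (HCell.of (hor M))) tensorUnitComparison.hom ≫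
        (tensorComparison M (C.U (𝟙_ C.Obj))).hom ≫ sq (C.tensorRightUnitor M).hom =
      (D.tensorRightUnitor (hor M)).hom
  /-- the composition comparison is monoidal: compatibility with tensor products -/
  compComparison_tensor : ∀ {a b c a' b' c' : C.Obj} (M : C.Hor a b) (M' : C.Hor a' b')
    (N : C.Hor b c) (N' : C.Hor b' c'),
    (D.interchange (hor M) (hor M') (hor N) (hor N')).hom ≫
        D.tensorMap (compComparison M N).hom (compComparison M' N').hom ≫
        (tensorComparison (C.comp M N) (C.comp M' N')).hom =
      D.hcomp (tensorComparison M M').hom (tensorComparison N N').hom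
          ((T_tensorComparison M M').trans (S_tensorComparison N N').symm) ≫
        (compComparison (C.tensor M M') (C.tensor N N')).hom ≫ sq (C.interchange M M' N N').hom
  /-- the composition comparison is monoidal: compatibility with units -/
  compComparison_tensorUnit :
    D.hcomp tensorUnitComparison.hom tensorUnitComparison.hom
          (T_tensorUnitComparison.trans S_tensorUnitComparison.symm) ≫
        (compComparison (C.U (𝟙_ C.Obj)) (C.U (𝟙_ C.Obj))).hom ≫
        sq (C.leftUnitor (C.U (𝟙_ C.Obj))).hom =
      (D.leftUnitor (D.U (𝟙_ D.Obj))).hom ≫ tensorUnitComparison.hom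
  /-- the identity comparison is monoidal: compatibility with tensor products -/
  idComparison_tensor : ∀ a b : C.Obj,
    D.Umap (μ F0 a b) ≫ (idComparison (a ⊗ b)).hom ≫ sq (C.unitComparison a b).hom =
      (D.unitComparison (F0.obj a) (F0.obj b)).hom ≫
        D.tensorMap (idComparison a).hom (idComparison b).hom ≫
        (tensorComparison (C.U a) (C.U b)).hom
  /-- the identity comparison is monoidal: compatibility with units -/
  idComparison_tensorUnit :
    D.Umap (ε F0) ≫ (idComparison (𝟙_ C.Obj)).hom = tensorUnitComparison.hom

attribute [instance] MonoidalDoubleFunctor.mon₀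

open Functor.LaxMonoidal (μ) in
/-- A symmetric monoidal double functor: a monoidal double functor such that `F0` and `F1` are
symmetric monoidal functors. -/
structure SymmetricMonoidalDoubleFunctor (C : SymmetricMonoidalDoubleCategory.{v₀, u₀, v₁, u₁})
    (D : SymmetricMonoidalDoubleCategory.{v₀', u₀', v₁', u₁'}) extends
    MonoidalDoubleFunctor C.toMonoidalDoubleCategory D.toMonoidalDoubleCategory where
  braided₀ : ∀ a b : C.Obj,
    μ F0 a b ≫ F0.map (β_ a b).hom = (β_ (F0.obj a) (F0.obj b)).hom ≫ μ F0 b a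
  braided₁ : ∀ {a b c d : C.Obj} (M : C.Hor a b) (N : C.Hor c d),
    (tensorComparison M N).hom ≫ sq (C.braiding M N).hom =
      (D.braiding (hor M) (hor N)).hom ≫ (tensorComparison N M).hom

/-! ### Open Petri nets and open commutative monoidal categories -/

/-- The functor from sets to commutative monoidal categories that sends `X` to the free commutative
monoidal category on the Petri net with places `X` and no transitions. -/
abbrev CMC.L' : Type u ⥤ CMC.{u} := PetriNet.L ⋙ CMC.F

/-- The symmetric monoidal double category of open Petri nets. -/
noncomputable def OpenPetri : SymmetricMonoidalDoubleCategory.{u, u + 1, u, u + 1} :=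
  StructuredCospan.symmetricMonoidalDoubleCategory PetriNet.L.{u}

/-- The symmetric monoidal double category of open commutative monoidal categories. -/
noncomputable def OpenCMC : SymmetricMonoidalDoubleCategory.{u, u + 1, u, u + 1} :=
  StructuredCospan.symmetricMonoidalDoubleCategory CMC.L'.{u}

/-- The action of `Open(F)`: it is the identity on objects and vertical 1-morphisms, it sends an
open Petri net `L X ⟶ P ⟵ L Y` to `F (L X) ⟶ F P ⟵ F (L Y)`, and it sends a 2-morphism
`(f, g, α)` to `(f, g, F α)`. -/
noncomputable def openF : DoubleFunctorData OpenPetri.{u}.toDoubleCategory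
    OpenCMC.{u}.toDoubleCategory where
  F0 := 𝟭 (Type u)
  hor {X Y} (M : StructuredCospan PetriNet.L X Y) :=
    (⟨CMC.F.obj M.apex, CMC.F.map M.left, CMC.F.map M.right⟩ : StructuredCospan CMC.L' X Y)
  sq {_ _ _ _ M N} (α : StructuredCospan.Hom (HCell.of M) (HCell.of N)) :=
    ⟨α.src, α.tgt, CMC.F.map α.mid,
      by
        rw [← CMC.F.map_comp, α.left_comm, CMC.F.map_comp]; rfl,
      by
        rw [← CMC.F.map_comp, α.right_comm, CMC.F.map_comp]; rfl⟩
  S_sq _ := rfl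
  T_sq _ := rfl
  sq_id _ := StructuredCospan.Hom.ext rfl rfl (CMC.F.map_id _)
  sq_comp _ _ := StructuredCospan.Hom.ext rfl rfl (CMC.F.map_comp _ _)

/-! Petri nets enter only through a few facts: `PetriNet` and `CMC` have colimits, and `PetriNet.L`
and `CMC.F` are left adjoints. The real content is a general principle. Let `L : A ⥤ X` and `G : X ⥤
Y` be left adjoints, where `A` has finite coproducts and `X` and `Y` have finite colimits. Then
applying `G` to apices and legs carries cospans structured by `L` to cospans structured by `L ⋙ G`,
and it respects all the structure. Since `CMC.L'` is by definition `PetriNet.L ⋙ CMC.F`, the theorem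
is one instance of this.

The reason is that every operation on structured cospans is a colimit: horizontal composition is a
pushout over `L b`, the tensor product is a binary coproduct, and the tensor unit is `L` of the
initial object. A left adjoint preserves these colimits, although not the chosen ones on the nose.
So the canonical arrows from the colimit of the images to the image of the colimit are invertible,
and they serve as the comparisons (`mapCompIso`, `mapTensorIso`). Identity cospans have the same
apex on both sides, and their comparison `mapUnitIso` is the image of an identity.

Coherence then follows from universal properties. By `hom_ext`, an equation of 2-morphisms splits
into its two vertical boundaries and its map of apices. The functor on objects is the identity and
the comparisons are globular, so the boundaries are equations between structural maps of `A`
composed with identities. The apex equation compares two arrows out of an iterated colimit, and it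
suffices to test them on each piece: `comp_hom_ext` for pushouts, `t_hom_ext` for coproducts,
`unit_hom_ext` for identity cospans, and `l_hom_ext` for values of `L ⋙ G` at a coproduct. On a
piece, both sides become the image under `G` of one and the same arrow, because the comparisons send
inclusions to images of inclusions and all structural isomorphisms are determined by their effect on
inclusions. A piece which is the image of the initial object needs no computation at all, by
`lInitial`. -/

namespace StructuredCospan

-- Structured cospans under a functor

universe vA uA vX uX vY uY

attribute [local instance] coprodMonoidal coprodSymmetric

variable {A : Type uA} [Category.{vA} A] {X : Type uX} [Category.{vX} X]
  {Y : Type uY} [Category.{vY} Y] {L : A ⥤ X} (G : X ⥤ Y)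

/-- The image of a structured cospan under a functor. -/
def mapCospan {a b : A} (M : StructuredCospan L a b) : StructuredCospan (L ⋙ G) a b :=
  ⟨G.obj M.apex, G.map M.left, G.map M.right⟩

section

variable {a b a' b' a'' b'' : A} {M : StructuredCospan L a b} {N : StructuredCospan L a' b'}
  {P : StructuredCospan L a'' b''} {c d : A}

/-- The image of a map of apices. -/
def mapApex (k : M.apex ⟶ N.apex) : (mapCospan G M).apex ⟶ (mapCospan G N).apex := G.map k

/-- The image of a leg. -/
def mapLeg (k : L.obj c ⟶ M.apex) : (L ⋙ G).obj c ⟶ (mapCospan G M).apex := G.map k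

-- `mapApex` and `mapLeg` are plain applications of `G`, typed so that the rules for cospans over `L
-- ⋙ G` recognise their ends. The rewriting rules of this group express legs of images by `mapLeg`
-- and gather a chain of images into the image of one composite. Inside that single image the rules
-- for cospans over `L`, such as `compInl_desc`, `tInl_desc` and `left_mid`, finish the computation.
@[simp] theorem mapCospan_left : (mapCospan G M).left = mapLeg G M.left := rfl
@[simp] theorem mapCospan_right : (mapCospan G M).right = mapLeg G M.right := rfl
@[simp] theorem mapApex_id : mapApex G (𝟙 M.apex) = 𝟙 (mapCospan G M).apex := G.map_id _
@[simp] theorem mapApex_comp (k : M.apex ⟶ N.apex) (l : N.apex ⟶ P.apex) :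
    mapApex G k ≫ mapApex G l = mapApex G (k ≫ l) := (G.map_comp k l).symm
@[simp] theorem mapLeg_comp (k : L.obj c ⟶ M.apex) (l : M.apex ⟶ N.apex) :
    mapLeg G k ≫ mapApex G l = mapLeg G (k ≫ l) := (G.map_comp k l).symm
-- A vertical boundary `f` of a 2-morphism over `L ⋙ G` occurs as `G.map (L.map f)`; this rule
-- absorbs it into the image of a leg.
@[simp] theorem map_mapLeg (f : c ⟶ d) (k : L.obj d ⟶ M.apex) :
    G.map (L.map f) ≫ mapLeg G k = mapLeg G (L.map f ≫ k) := (G.map_comp (L.map f) k).symm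

/-- The image of a 2-morphism of structured cospans. -/
@[simps]
def mapSq (α : HCell.of M ⟶ HCell.of N) : HCell.of (mapCospan G M) ⟶ HCell.of (mapCospan G N) :=
  -- The two compatibility conditions are the images under `G` of those of `α`.
  ⟨α.src, α.tgt, mapApex G α.mid, by simp, by simp⟩

end

/-- The comparison between the identity cospan and the image of the identity cospan. -/
def mapUnitIso (L : A ⥤ X) (a : A) :
    HCell.of (unit (L ⋙ G) a) ≅ HCell.of (mapCospan G (unit L a)) :=
  isoMk (Iso.refl _) (Iso.refl _)
    -- Both apices are `G (L a)`, but the legs are the identity on one side and `G` of the identity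
    -- on the other. The comparison is therefore `G` of an identity, and functoriality makes it
    -- inverse to the identity. Writing it with `unitDesc` makes it computable on the leg of the
    -- unit cospan.
    { hom := unitDesc (mapLeg G (unit L a).left)
      inv := 𝟙 (G.obj (L.obj a))
      hom_inv_id := (Category.comp_id _).trans (G.map_id _)
      inv_hom_id := (Category.id_comp _).trans (G.map_id _) }
    (by simp) (by simp [unit_right])

/-! ### Preservation of pushouts and the double functor -/

section comp

variable [HasPushouts X] [HasPushouts Y] [PreservesColimitsOfShape WalkingSpan G]

/-- The comparison between the composite of images and the image of a composite. -/
noncomputable def mapCompIso {a b c : A} (M : StructuredCospan L a b)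
    (N : StructuredCospan L b c) :
    HCell.of (comp (mapCospan G M) (mapCospan G N)) ≅ HCell.of (mapCospan G (comp M N)) :=
  isoMk (Iso.refl _) (Iso.refl _)
    -- This is the canonical arrow from the pushout of the images to the image of the pushout, given
    -- by its values on the inclusions, since all later computations use just these values. Its
    -- compatibility condition is `G` applied to the pushout square.
    { hom := compDesc (mapApex G (compInl M N)) (mapApex G (compInr M N))
        (by simp [comp_condition])
      -- Invertibility is where preservation of pushouts enters.
      inv := (PreservesPushout.iso G M.right N.left).inv
      hom_inv_id := by
        -- Both inverse laws amount to saying that the arrow above is the forward map of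
        -- `PreservesPushout.iso`. The two agree on both inclusions of the pushout, hence are equal.
        refine (Iso.comp_inv_eq (PreservesPushout.iso G M.right N.left)).2
          (comp_hom_ext ?_ ?_)
        · rw [compInl_desc]
          exact ((congrArg _ (Category.id_comp _)).trans
            (PreservesPushout.inl_iso_hom G M.right N.left)).symm
        · rw [compInr_desc]
          exact ((congrArg _ (Category.id_comp _)).trans
            (PreservesPushout.inr_iso_hom G M.right N.left)).symm
      inv_hom_id := by
        refine (Iso.inv_comp_eq (PreservesPushout.iso G M.right N.left)).2
          (comp_hom_ext ?_ ?_)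
        · rw [compInl_desc]
          exact ((congrArg _ (Category.comp_id _)).trans
            (PreservesPushout.inl_iso_hom G M.right N.left)).symm
        · rw [compInr_desc]
          exact ((congrArg _ (Category.comp_id _)).trans
            (PreservesPushout.inr_iso_hom G M.right N.left)).symm }
    (by simp) (by simp)

variable (L) in
/-- Postcomposition with a pushout-preserving functor, as a double functor between double
categories of structured cospans. -/
noncomputable abbrev mapDoubleFunctor :
    DoubleFunctor (doubleCategory L) (doubleCategory (L ⋙ G)) where
  -- With the identity functor here, the source and target conditions on 2-morphisms and comparisons
  -- hold by `rfl`.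
  F0 := 𝟭 A
  hor := mapCospan G
  sq := mapSq G
  S_sq _ := rfl
  T_sq _ := rfl
  sq_id _ := hom_ext rfl rfl (G.map_id _)
  sq_comp _ _ := hom_ext rfl rfl (G.map_comp _ _)
  compComparison := mapCompIso G
  S_compComparison _ _ := rfl
  T_compComparison _ _ := rfl
  compComparison_natural α β h := by
    apply hom_ext
    · simp [mapCompIso]
    · simp [mapCompIso]
    -- On the first piece, both sides are the image under `G` of `α.mid` followed by the first
    -- inclusion; the second piece is the same with `β`.
    · apply comp_hom_ext <;> simp [mapCompIso]
  idComparison := mapUnitIso G L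
  S_idComparison _ := rfl
  T_idComparison _ := rfl
  idComparison_natural f := by
    apply hom_ext
    · simp [mapUnitIso]
    · simp [mapUnitIso]
    -- On the leg of the unit cospan, both sides are `G` of `L.map f` followed by the leg of the
    -- unit at `b`.
    · apply unit_hom_ext; simp [mapUnitIso]
  compComparison_assoc M N P := by
    apply hom_ext
    · simp [mapCompIso, assoc]
    · simp [mapCompIso, assoc]
    -- The domain is glued from three apices. On each of them, both sides are `G` of its inclusion
    -- into the composite of `M` with the composite of `N` and `P`.
    · apply comp_hom_ext
      · apply comp_hom_ext <;> simp [mapCompIso, assoc]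
      · simp [mapCompIso, assoc]
  compComparison_leftUnitor M := by
    apply hom_ext
    · simp [mapCompIso, mapUnitIso, leftUnitor]
    · simp [mapCompIso, mapUnitIso, leftUnitor]
    · apply comp_hom_ext
      -- On the unit piece both sides are the image of `M.left`; on the other piece both are the
      -- identity.
      · apply unit_hom_ext; simp [mapCompIso, mapUnitIso, leftUnitor]
      · simp [mapCompIso, leftUnitor]
  compComparison_rightUnitor M := by
    apply hom_ext
    · simp [mapCompIso, mapUnitIso, rightUnitor]
    · simp [mapCompIso, mapUnitIso, rightUnitor]
    · apply comp_hom_ext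
      · simp [mapCompIso, rightUnitor]
      · apply unit_hom_ext
        -- `unit_hom_ext` tests on the left leg of the unit cospan, which is also its right leg;
        -- `rightUnitor` is described by the right leg of `M`.
        simp [mapCompIso, mapUnitIso, rightUnitor, ← unit_right]

end comp

/-! ### Preservation of coproducts and the monoidal structure -/

section tensor

variable [HasFiniteCoproducts A]

section

variable {a b c d : A} {M : StructuredCospan L a b}

-- The inclusion for `L ⋙ G` is by definition `G` of the inclusion for `L`, both coming from the
-- same inclusion in `A`. Testing with `l_hom_ext` over `L ⋙ G` thus reduces to the known rules over
-- `L`.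
@[simp] theorem lInl_mapLeg (k : L.obj (c ⊗ d) ⟶ M.apex) :
    lInl (L ⋙ G) c d ≫ mapLeg G k = mapLeg G (lInl L c d ≫ k) :=
  (G.map_comp (lInl L c d) k).symm
@[simp] theorem lInr_mapLeg (k : L.obj (c ⊗ d) ⟶ M.apex) :
    lInr (L ⋙ G) c d ≫ mapLeg G k = mapLeg G (lInr L c d ≫ k) :=
  (G.map_comp (lInr L c d) k).symm

end

variable [HasFiniteColimits X] [HasFiniteColimits Y] [L.IsLeftAdjoint] [G.IsLeftAdjoint]

/-- The comparison between the tensor product of images and the image of a tensor product. -/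
noncomputable def mapTensorIso {a b c d : A} (M : StructuredCospan L a b)
    (N : StructuredCospan L c d) :
    HCell.of (tensor (mapCospan G M) (mapCospan G N)) ≅ HCell.of (mapCospan G (tensor M N)) :=
  isoMk (Iso.refl _) (Iso.refl _)
    -- As for pushouts, the arrow is given by its values on inclusions, while its inverse comes from
    -- `G` preserving binary coproducts. The inverse laws hold because it is the forward map of
    -- `PreservesColimitPair.iso`.
    { hom := tDesc (mapApex G (tInl M N)) (mapApex G (tInr M N))
      inv := (PreservesColimitPair.iso G M.apex N.apex).inv
      hom_inv_id := by
        refine (Iso.comp_inv_eq (PreservesColimitPair.iso G M.apex N.apex)).2 (t_hom_ext ?_ ?_)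
        · rw [tInl_desc]
          exact ((congrArg _ (Category.id_comp _)).trans
            (coprodComparison_inl G (A := M.apex) (B := N.apex))).symm
        · rw [tInr_desc]
          exact ((congrArg _ (Category.id_comp _)).trans
            (coprodComparison_inr G (A := M.apex) (B := N.apex))).symm
      inv_hom_id := by
        refine (Iso.inv_comp_eq (PreservesColimitPair.iso G M.apex N.apex)).2 (t_hom_ext ?_ ?_)
        · rw [tInl_desc]
          exact ((congrArg _ (Category.comp_id _)).trans
            (coprodComparison_inl G (A := M.apex) (B := N.apex))).symm
        · rw [tInr_desc]
          exact ((congrArg _ (Category.comp_id _)).trans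
            (coprodComparison_inr G (A := M.apex) (B := N.apex))).symm }
    -- The legs contain `lSplit` for `L ⋙ G` on one side and the image of `lSplit` for `L` on the
    -- other. Precomposing with the two coproduct inclusions removes both, leaving on each summand
    -- the image of a leg followed by an inclusion.
    (by apply l_hom_ext <;> simp) (by apply l_hom_ext <;> simp)

variable (L) in
/-- Postcomposition with a left adjoint, as a monoidal double functor between monoidal double
categories of structured cospans. -/
noncomputable abbrev mapMonoidalDoubleFunctor :
    MonoidalDoubleFunctor (monoidalDoubleCategory L) (monoidalDoubleCategory (L ⋙ G)) where
  -- As a left adjoint, `G` preserves pushouts.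
  toDoubleFunctor := mapDoubleFunctor L G
  -- The structure maps `μ` and `ε` of the identity functor are identities, so globular comparisons
  -- have the required source and target.
  mon₀ := inferInstanceAs (𝟭 A).Monoidal
  tensorComparison := mapTensorIso G
  S_tensorComparison _ _ := rfl
  T_tensorComparison _ _ := rfl
  tensorComparison_natural α β := by
    apply hom_ext
    · simp [mapTensorIso]
    · simp [mapTensorIso]
    · apply t_hom_ext <;> simp [mapTensorIso]
  -- The choice is forced: `ε` is an identity, so `idComparison_tensorUnit` requires the identity
  -- comparison at the tensor unit.
  tensorUnitComparison := mapUnitIso G L (𝟙_ A)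
  S_tensorUnitComparison := rfl
  T_tensorUnitComparison := rfl
  tensorComparison_assoc M N P := by
    apply hom_ext
    · simp [mapTensorIso, tensorAssoc]
    · simp [mapTensorIso, tensorAssoc]
    · apply t_hom_ext
      · apply t_hom_ext <;> simp [mapTensorIso, tensorAssoc]
      · simp [mapTensorIso, tensorAssoc]
  tensorComparison_leftUnitor M := by
    apply hom_ext
    · simp [mapTensorIso, mapUnitIso, tensorLeftUnitor]
    · simp [mapTensorIso, mapUnitIso, tensorLeftUnitor]
    · apply t_hom_ext
      · apply unit_hom_ext
        -- This piece is the image of the initial object under the left adjoint `L ⋙ G`, hence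
        -- initial, and any two arrows out of it agree.
        exact (lInitial (L ⋙ G)).hom_ext _ _
      · simp [mapTensorIso, tensorLeftUnitor]
  tensorComparison_rightUnitor M := by
    apply hom_ext
    · simp [mapTensorIso, mapUnitIso, tensorRightUnitor]
    · simp [mapTensorIso, mapUnitIso, tensorRightUnitor]
    · apply t_hom_ext
      · simp [mapTensorIso, tensorRightUnitor]
      · apply unit_hom_ext
        exact (lInitial (L ⋙ G)).hom_ext _ _
  compComparison_tensor M M' N N' := by
    apply hom_ext
    · simp [mapTensorIso, mapCompIso, interchange]
    · simp [mapTensorIso, mapCompIso, interchange]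
    -- The domain is a pushout of two coproducts. On each of its four apices, both sides are `G` of
    -- the inclusion into the tensor product of the two composites.
    · apply comp_hom_ext <;> apply t_hom_ext <;> simp [mapTensorIso, mapCompIso, interchange]
  compComparison_tensorUnit := by
    apply hom_ext
    · simp [mapCompIso, mapUnitIso, leftUnitor]
    · simp [mapCompIso, mapUnitIso, leftUnitor]
    -- Both pieces of the pushout are initial.
    · apply comp_hom_ext <;> apply unit_hom_ext <;> exact (lInitial (L ⋙ G)).hom_ext _ _
  idComparison_tensor a b := by
    apply hom_ext
    · simp [mapTensorIso, mapUnitIso, unitComparison]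
    · simp [mapTensorIso, mapUnitIso, unitComparison]
    · apply unit_hom_ext
      -- On the summands at `a` and `b`, both sides are `G` of the leg of a unit cospan followed by
      -- a coproduct inclusion.
      apply l_hom_ext <;> simp [mapTensorIso, mapUnitIso, unitComparison]
  idComparison_tensorUnit := by
    apply hom_ext
    · simp [mapUnitIso]
    · simp [mapUnitIso]
    · apply unit_hom_ext
      exact (lInitial (L ⋙ G)).hom_ext _ _

/-! ### Compatibility with the symmetry -/

variable (L) in
/-- Postcomposition with a left adjoint, as a symmetric monoidal double functor between symmetric
monoidal double categories of structured cospans. -/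
noncomputable abbrev mapSymmetricMonoidalDoubleFunctor :
    SymmetricMonoidalDoubleFunctor (symmetricMonoidalDoubleCategory L)
      (symmetricMonoidalDoubleCategory (L ⋙ G)) where
  toMonoidalDoubleFunctor := mapMonoidalDoubleFunctor L G
  -- Since `μ` is an identity, both sides are the braiding of `A`.
  braided₀ a b := (Category.id_comp _).trans (Category.comp_id _).symm
  braided₁ M N := by
    apply hom_ext
    · simp [mapTensorIso, braiding]
    · simp [mapTensorIso, braiding]
    -- On each summand, both sides are `G` of the inclusion into the swapped coproduct.
    · apply t_hom_ext <;> simp [mapTensorIso, braiding]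

end tensor

end StructuredCospan

/-! ### The case of open Petri nets -/

theorem mainTheorem3 :
    ∃ Φ : SymmetricMonoidalDoubleFunctor OpenPetri.{u} OpenCMC.{u},
      Φ.toDoubleFunctorData = openF.{u} :=
  -- `CMC.L'` unfolds to `PetriNet.L ⋙ CMC.F`, so the target of the general functor is `OpenCMC`.
  -- Its data are those of `openF`, up to proofs of the compatibility conditions, which are
  -- irrelevant; hence `rfl`.
  ⟨StructuredCospan.mapSymmetricMonoidalDoubleFunctor PetriNet.L.{u} CMC.F.{u}, rfl⟩
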